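/- For an integer $N\ge 1$, a real $\delta>0$ and a function $f:[N,2N]\to\mathbb{R}$, let $\mathcal{R}(f,N,\delta)$ be the number of integers $n\in[N,2N]$ with $\|f(n)\|<\delta$, where $\|y\|$ denotes the distance from $y$ to the nearest integer. Let $k\ge 1$ be an integer and let $(c_j)_{j\ge 0}$ be a sequence of real numbers $c_j\ge 1$. There is a constant $C>0$, depending only on $k$ and on $(c_j)_{j\ge0}$, such that the following holds. Let $N\ge 1$ be an integer, let $\delta>0$ and $T\ge 1$ be real numbers, and let $f\in C^\infty[N,2N]$ be real-valued with $$c_j^{-1}\,\frac{T}{N^j}\;\le\;|f^{(j)}(x)|\;\le\; c_j\,\frac{T}{N^j}\qquad\text{for all } x\in[N,2N] \text{ and all integers } j\ge 0 .$$ If $N\delta\le T\le\delta^{-1}$, then $$\mathcal{R}(f,N,\delta)\;\le\; C\,T^{\frac{2}{k(k+1)}}\,N^{\frac{k-1}{k+1}} .$$ -/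

import Mathlib

open Set
open scoped ContDiff

/-- Distance `‖x‖` from a real number to the nearest integer. -/
noncomputable def distNearestInt (x : ℝ) : ℝ := |x - (round x : ℝ)|

/-- `𝒮(f, N, δ)`: the integers `n ∈ [N, 2N]` with `‖f(n)‖ < δ`. -/
def closePoints (f : ℝ → ℝ) (N : ℕ) (δ : ℝ) : Set ℤ :=
  {n : ℤ | (N : ℤ) ≤ n ∧ n ≤ 2 * (N : ℤ) ∧ distNearestInt (f (n : ℝ)) < δ}

/-- The set `𝒮(f, N, δ)` is finite, so its `ncard` is its true cardinality. -/
theorem closePoints_finite (f : ℝ → ℝ) (N : ℕ) (δ : ℝ) : (closePoints f N δ).Finite :=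
  (Set.finite_Icc (N : ℤ) (2 * (N : ℤ))).subset fun _ hn => ⟨hn.1, hn.2.1⟩

/-- `ℛ(f, N, δ) = |𝒮(f, N, δ)|`. -/
noncomputable def closeCount (f : ℝ → ℝ) (N : ℕ) (δ : ℝ) : ℕ :=
  (closePoints f N δ).ncard

/-- `f ∈ C^∞[N, 2N]` and `|f^{(j)}(x)| ≍ T / N^j` on `[N, 2N]` for every `j ≥ 0`, the implied
constant for the `j`-th derivative being `c j`. Derivatives are one-sided at the end points. -/
def DerivsComparable (c : ℕ → ℝ) (N : ℕ) (T : ℝ) (f : ℝ → ℝ) : Prop :=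
  ContDiffOn ℝ ∞ f (Icc (N : ℝ) (2 * N)) ∧
    ∀ j : ℕ, ∀ x ∈ Icc (N : ℝ) (2 * N),
      (c j)⁻¹ * (T / (N : ℝ) ^ j) ≤ |iteratedDerivWithin j f (Icc (N : ℝ) (2 * N)) x| ∧
        |iteratedDerivWithin j f (Icc (N : ℝ) (2 * N)) x| ≤ c j * (T / (N : ℝ) ^ j)

/-! Write X for `mainTerm k N T`, so that X^(k(k+1)/2) = T N^(k(k-1)/2), and cut [N, 2N] into about
X blocks of length L ≍ N/X. Suppose f(n) is within δ of an integer m(n) at k + 1 integers n of a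
block. The k-th divided difference of f times the Vandermonde determinant is O(L^(k(k+1)/2) T/N^k),
which is small by the choice of L. Replacing f by m costs O(δ L^(k(k-1)/2)) and produces an integer,
which must therefore vanish. So the points (n, m(n)) of a block lie on one polynomial p of degree <
k (`exists_polynomial_of_close`).

Blocks with boundedly many points contribute O(X). For the dense ones, f - p has the same k-th
derivative as f, without zeros, so by Rolle it has at most k monotone pieces. Points on one p and
one piece force |f - p| < δ on the whole interval between them, an arc, and the size of f^(k) bounds
its length (`IsDerivTower.length_le`). Away from the arc f - p grows slowly. A dense block also
contains k integers close together, so p has a small common denominator at integers. Hence every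
close point in a wide neighbourhood of the arc lies on p as well (`eval_eq_of_near_arc`).

Two polynomials of degree < k agreeing at k points are equal, so arcs of different polynomials repel
each other. The width of the neighbourhood controls the number of points on the arc (`exists_arc`),
and all widths but one have sum O(N) (`sum_radius_le`). Thus all arcs but one carry O(N/L) = O(X)
points, and the last is too short to carry more than O(X) integers.

This needs k ≥ 3, for k ≤ k(k-1)/2, and T² ≥ N^(k-1), for δ L^(k(k-1)/2) ≤ δT ≤ 1. If T² ≤ N^(k-1),
the bound for k - 1 is at least as strong (`mainTerm_le_succ`); hence the induction on k. The case k
= 1 is the mean value theorem, and k = 2 counts consecutive close points by their gap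
(`card_gap_le`). -/

/-! ### Towers of derivatives and Rolle's theorem -/

/-- `F 0, F 1, F 2, …` are successive derivatives of each other on `I`. -/
def IsDerivTower (I : Set ℝ) (F : ℕ → ℝ → ℝ) : Prop :=
  ∀ j, ∀ x ∈ I, HasDerivWithinAt (F j) (F (j + 1) x) I x

theorem IsDerivTower.shift {I : Set ℝ} {F : ℕ → ℝ → ℝ} (h : IsDerivTower I F) :
    IsDerivTower I (fun j => F (j + 1)) := fun j => h (j + 1)

theorem IsDerivTower.sub {I : Set ℝ} {F G : ℕ → ℝ → ℝ} (hF : IsDerivTower I F)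
    (hG : IsDerivTower I G) : IsDerivTower I (fun j x => F j x - G j x) :=
  fun j x hx => (hF j x hx).sub (hG j x hx)

theorem IsDerivTower.mono {I J : Set ℝ} {F : ℕ → ℝ → ℝ} (hF : IsDerivTower I F) (hJ : J ⊆ I) :
    IsDerivTower J F := fun j x hx => (hF j x (hJ hx)).mono hJ

theorem IsDerivTower.continuousOn {I : Set ℝ} {F : ℕ → ℝ → ℝ} (hF : IsDerivTower I F) (j : ℕ) :
    ContinuousOn (F j) I := fun x hx => (hF j x hx).continuousWithinAt

theorem IsDerivTower.hasDerivAt {a b : ℝ} {F : ℕ → ℝ → ℝ} (hF : IsDerivTower (Icc a b) F)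
    (j : ℕ) {x : ℝ} (hx : x ∈ Ioo a b) : HasDerivAt (F j) (F (j + 1) x) x :=
  (hF j x (Ioo_subset_Icc_self hx)).hasDerivAt (Icc_mem_nhds hx.1 hx.2)

/-- The derivatives of a polynomial. -/
noncomputable def polyTower (p : Polynomial ℝ) (j : ℕ) (x : ℝ) : ℝ :=
  (Polynomial.derivative^[j] p).eval x

theorem isDerivTower_polyTower (I : Set ℝ) (p : Polynomial ℝ) :
    IsDerivTower I (polyTower p) := by
  intro j x _
  unfold polyTower
  rw [Function.iterate_succ_apply']
  exact (Polynomial.hasDerivAt _ x).hasDerivWithinAt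

theorem polyTower_eq_zero {p : Polynomial ℝ} {k : ℕ} (hp : p.degree < k) (x : ℝ) :
    polyTower p k x = 0 := by
  unfold polyTower
  rcases eq_or_ne p 0 with rfl | h0
  · simp
  · rw [Polynomial.iterate_derivative_eq_zero ((Polynomial.natDegree_lt_iff_degree_lt h0).2 hp)]
    simp

theorem polyTower_top {p : Polynomial ℝ} {k : ℕ} (hp : p.natDegree ≤ k) (x : ℝ) :
    polyTower p k x = k.factorial * p.coeff k := by
  unfold polyTower
  have h1 : (Polynomial.derivative^[k] p).natDegree = 0 := by
    have := Polynomial.natDegree_iterate_derivative p k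
    omega
  rw [Polynomial.eq_C_of_natDegree_eq_zero h1, Polynomial.eval_C,
    Polynomial.coeff_iterate_derivative]
  simp [Nat.descFactorial_self]

/-- Iterated Rolle for strictly increasing zeros. -/
theorem IsDerivTower.exists_zero_of_strictMono {a b : ℝ} :
    ∀ (k : ℕ) {F : ℕ → ℝ → ℝ}, IsDerivTower (Icc a b) F → ∀ x : Fin (k + 1) → ℝ, StrictMono x →
      (∀ i, x i ∈ Icc a b) → (∀ i, F 0 (x i) = 0) → ∃ ξ ∈ Icc a b, F k ξ = 0
  | 0, _, _, x, _, hxm, hx0 => ⟨x 0, hxm 0, hx0 0⟩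
  | k + 1, F, hF, x, hx, hxm, hx0 => by
    have key : ∀ i : Fin (k + 1), ∃ y ∈ Ioo (x i.castSucc) (x i.succ), F 1 y = 0 := by
      intro i
      have hlt : x i.castSucc < x i.succ := hx Fin.castSucc_lt_succ
      have hsub : Icc (x i.castSucc) (x i.succ) ⊆ Icc a b :=
        Icc_subset_Icc (hxm _).1 (hxm _).2
      exact exists_hasDerivAt_eq_zero hlt ((hF.continuousOn 0).mono hsub)
        (by rw [hx0, hx0]) (fun y hy => (hF.mono hsub).hasDerivAt 0 hy)
    choose y hy hy0 using key
    obtain ⟨ξ, hξ, h0⟩ := exists_zero_of_strictMono k hF.shift y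
      (Fin.strictMono_iff_lt_succ.2 fun i => by
        have h1 := (hy i.castSucc).2
        have h2 := (hy i.succ).1
        rw [Fin.succ_castSucc] at h1
        exact h1.trans h2)
      (fun i => ⟨(hxm _).1.trans (hy i).1.le, (hy i).2.le.trans (hxm _).2⟩) hy0
    exact ⟨ξ, hξ, h0⟩

/-- Iterated Rolle: `k + 1` zeros of a function force a zero of its `k`-th derivative. -/
theorem IsDerivTower.exists_zero {a b : ℝ} {F : ℕ → ℝ → ℝ} (hF : IsDerivTower (Icc a b) F)
    {k : ℕ} (Z : Finset ℝ) (hZ : k + 1 ≤ Z.card) (hZm : ∀ z ∈ Z, z ∈ Icc a b)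
    (hZ0 : ∀ z ∈ Z, F 0 z = 0) : ∃ ξ ∈ Icc a b, F k ξ = 0 :=
  hF.exists_zero_of_strictMono k (fun i => Z.orderEmbOfFin rfl (i.castLE hZ))
    (fun i j hij => (Z.orderEmbOfFin rfl).strictMono (by simpa using hij))
    (fun i => hZm _ (Z.orderEmbOfFin_mem rfl _)) (fun i => hZ0 _ (Z.orderEmbOfFin_mem rfl _))

/-! ### Vandermonde determinants and divided differences -/

/-- The Vandermonde determinant. -/
noncomputable def vand {R : Type*} [CommRing R] {n : ℕ} (v : Fin n → R) : R :=
  (Matrix.vandermonde v).det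

/-- The alternating sum `det (v i ^ j | g i)` expanded along its last column. -/
noncomputable def altSum {R : Type*} [CommRing R] {k : ℕ} (v g : Fin (k + 1) → R) : R :=
  ∑ i : Fin (k + 1), (-1) ^ ((i : ℕ) + k) * g i * vand (fun j => v (i.succAbove j))

theorem altSum_eq_det {R : Type*} [CommRing R] {k : ℕ} (v g : Fin (k + 1) → R) :
    altSum v g = (Matrix.of fun i (j : Fin (k + 1)) =>
      if j = Fin.last k then g i else v i ^ (j : ℕ)).det := by
  rw [Matrix.det_succ_column _ (Fin.last k)]
  unfold altSum
  refine Finset.sum_congr rfl fun i _ => ?_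
  have : (fun a b => (Matrix.of fun i (j : Fin (k + 1)) =>
      if j = Fin.last k then g i else v i ^ (j : ℕ)) (i.succAbove a) ((Fin.last k).succAbove b))
      = Matrix.vandermonde (fun j => v (i.succAbove j)) := by
    ext a b
    simp [Matrix.vandermonde_apply, Fin.succAbove_last, Fin.castSucc_ne_last]
  rw [vand, ← this]
  simp [Matrix.submatrix]
  rfl

/-- The evaluation matrix is the Vandermonde matrix times an upper triangular matrix of coefficients
with diagonal 1, …, 1, `p.coeff k`. Thus `altSum` is the k-th divided difference multiplied by the
Vandermonde determinant. -/
theorem altSum_polynomial {k : ℕ} (v : Fin (k + 1) → ℝ) {p : Polynomial ℝ}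
    (hp : p.natDegree ≤ k) :
    altSum v (fun i => p.eval (v i)) = p.coeff k * vand v := by
  have h := Matrix.eval_matrixOfPolynomials_eq_vandermonde_mul_matrixOfPolynomials v
    (fun j : Fin (k + 1) => if j = Fin.last k then p else Polynomial.X ^ (j : ℕ)) (by
      intro j
      split_ifs with hj
      · subst hj; simpa using hp
      · simp)
  have h2 : (Matrix.of fun i (j : Fin (k + 1)) =>
      if j = Fin.last k then p.eval (v i) else v i ^ (j : ℕ)) =
      Matrix.of (fun i j => ((fun j : Fin (k + 1) =>
        if j = Fin.last k then p else Polynomial.X ^ (j : ℕ)) j).eval (v i)) := by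
    ext i j
    simp only [Matrix.of_apply]
    split_ifs <;> simp
  rw [altSum_eq_det, h2, h, Matrix.det_mul, mul_comm, vand]
  congr 1
  rw [Matrix.det_of_isUpperTriangular]
  · rw [Fin.prod_univ_castSucc]
    simp [Fin.castSucc_ne_last]
  · intro i j hij
    simp only [id] at hij
    simp only [Matrix.of_apply]
    have : j ≠ Fin.last k := fun hj => by
      subst hj; exact absurd hij (not_lt.2 (Fin.le_last i))
    rw [if_neg this, Polynomial.coeff_X_pow, if_neg]
    have := Fin.lt_def.1 hij
    omega

/-- The mean value theorem for divided differences, cleared of denominators. -/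
theorem IsDerivTower.altSum_eq {a b : ℝ} {F : ℕ → ℝ → ℝ} (hF : IsDerivTower (Icc a b) F)
    {k : ℕ} (v : Fin (k + 1) → ℝ) (hv : Function.Injective v) (hvm : ∀ i, v i ∈ Icc a b) :
    ∃ ξ ∈ Icc a b, altSum v (fun i => F 0 (v i)) = F k ξ / k.factorial * vand v := by
  -- `F 0 - p` vanishes at k + 1 nodes, so Rolle gives a point where `F k` equals the constant k!
  -- `p.coeff k`.
  set p := Lagrange.interpolate Finset.univ v (fun i => F 0 (v i)) with hp
  have hdeg : p.natDegree ≤ k := by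
    have h := Lagrange.degree_interpolate_lt (s := Finset.univ) (fun i => F 0 (v i)) hv.injOn
    rw [← hp] at h
    simp only [Finset.card_univ, Fintype.card_fin] at h
    rcases eq_or_ne p 0 with h0 | h0
    · simp [h0]
    · exact Nat.lt_succ_iff.1 ((Polynomial.natDegree_lt_iff_degree_lt h0).2 h)
  have hval : ∀ i, p.eval (v i) = F 0 (v i) := fun i =>
    Lagrange.eval_interpolate_at_node _ hv.injOn (Finset.mem_univ i)
  obtain ⟨ξ, hξ, h0⟩ := (hF.sub (isDerivTower_polyTower _ p)).exists_zero (k := k)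
    (Finset.univ.image v) (by rw [Finset.card_image_of_injective _ hv]; simp)
    (by simpa using hvm) (by simp [polyTower, hval])
  refine ⟨ξ, hξ, ?_⟩
  have h1 : F k ξ = k.factorial * p.coeff k := by
    rw [← polyTower_top hdeg ξ]; exact sub_eq_zero.1 h0
  rw [← funext hval, altSum_polynomial v hdeg, h1]
  congr 1
  rw [mul_div_cancel_left₀ _ (by positivity)]

theorem vand_ne_zero {n : ℕ} {v : Fin n → ℝ} (hv : Function.Injective v) : vand v ≠ 0 :=
  Matrix.det_vandermonde_ne_zero_iff.2 hv

theorem sum_card_Ioi_fin (n : ℕ) : ∑ i : Fin n, (Finset.Ioi i).card = n.choose 2 := by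
  simp only [Fin.card_Ioi]
  rw [Nat.choose_two_right, ← Finset.sum_range_id, ← Finset.sum_range_reflect,
    Finset.sum_range]

theorem abs_vand_le {n : ℕ} {v : Fin n → ℝ} {L : ℝ}
    (hv : ∀ i j, |v i - v j| ≤ L) : |vand v| ≤ L ^ n.choose 2 := by
  rw [vand, Matrix.det_vandermonde, Finset.abs_prod, ← sum_card_Ioi_fin,
    ← Finset.prod_pow_eq_pow_sum]
  refine Finset.prod_le_prod (fun _ _ => abs_nonneg _) fun i _ => ?_
  rw [Finset.abs_prod, ← Finset.prod_const]
  exact Finset.prod_le_prod (fun _ _ => abs_nonneg _) fun j _ => hv j i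

theorem le_abs_vand {n : ℕ} {v : Fin n → ℝ} {s : ℝ} (hs : 0 ≤ s)
    (hv : ∀ i j, i ≠ j → s ≤ |v i - v j|) : s ^ n.choose 2 ≤ |vand v| := by
  rw [vand, Matrix.det_vandermonde, Finset.abs_prod, ← sum_card_Ioi_fin,
    ← Finset.prod_pow_eq_pow_sum]
  refine Finset.prod_le_prod (fun _ _ => by positivity) fun i _ => ?_
  rw [Finset.abs_prod, ← Finset.prod_const]
  exact Finset.prod_le_prod (fun _ _ => hs) fun j hj => hv j i (Finset.mem_Ioi.1 hj).ne'

theorem vand_intCast {n : ℕ} (v : Fin n → ℤ) : vand (fun i => (v i : ℝ)) = (vand v : ℤ) := by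
  simp [vand, Matrix.det_vandermonde]

/-- Clearing denominators keeps the divided difference of integer data an integer, so a bound below
1 forces it to vanish. -/
theorem altSum_intCast {k : ℕ} (v g : Fin (k + 1) → ℤ) :
    altSum (fun i => (v i : ℝ)) (fun i => (g i : ℝ)) = (altSum v g : ℤ) := by
  simp [altSum, ← vand_intCast]

/-- Isolates the value at the last node, with the Vandermonde determinant of the other nodes as its
cofactor; the relation can then be solved for that value. -/
theorem altSum_snoc {R : Type*} [CommRing R] {k : ℕ} (x : Fin k → R) (y : R)
    (g : Fin (k + 1) → R) :
    altSum (Fin.snoc x y : Fin (k + 1) → R) g =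
      (∑ i : Fin k, (-1) ^ ((i : ℕ) + k) * g i.castSucc *
        vand (fun j => (Fin.snoc x y : Fin (k + 1) → R) (i.castSucc.succAbove j))) +
      g (Fin.last k) * vand x := by
  rw [altSum, Fin.sum_univ_castSucc]
  congr 1
  have h : ((-1 : R)) ^ (((Fin.last k : Fin (k + 1)) : ℕ) + k) = 1 := by
    rw [Fin.val_last, ← two_mul, pow_mul]; simp
  rw [h, one_mul]
  simp [Fin.succAbove_last]

theorem altSum_sub {R : Type*} [CommRing R] {k : ℕ} (v g h : Fin (k + 1) → R) :
    altSum v (fun i => g i - h i) = altSum v g - altSum v h := by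
  simp only [altSum, ← Finset.sum_sub_distrib]
  exact Finset.sum_congr rfl fun i _ => by ring

theorem abs_altSum_le {k : ℕ} {v g : Fin (k + 1) → ℝ} {L δ : ℝ} (hδ : 0 ≤ δ)
    (hv : ∀ i j, |v i - v j| ≤ L) (hg : ∀ i, |g i| ≤ δ) :
    |altSum v g| ≤ (k + 1) * δ * L ^ k.choose 2 := by
  refine (Finset.abs_sum_le_sum_abs _ _).trans ?_
  calc _ ≤ ∑ _i : Fin (k + 1), δ * L ^ k.choose 2 := by
        refine Finset.sum_le_sum fun i _ => ?_
        rw [abs_mul, abs_mul, abs_pow, abs_neg, abs_one, one_pow, one_mul]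
        exact mul_le_mul (hg i) (abs_vand_le fun _ _ => hv _ _) (abs_nonneg _) hδ
    _ = _ := by simp; ring

/-- In `altSum` of the monic nodal polynomial of `x`, every term except the one at `y` vanishes. -/
theorem vand_snoc {k : ℕ} (x : Fin k → ℝ) (y : ℝ) :
    vand (Fin.snoc x y : Fin (k + 1) → ℝ) = vand x * ∏ i, (y - x i) := by
  have h := altSum_polynomial (k := k) (Fin.snoc x y : Fin (k + 1) → ℝ)
    (p := Lagrange.nodal Finset.univ x) (by simp [Lagrange.natDegree_nodal])
  have hc : (Lagrange.nodal Finset.univ x).coeff k = 1 := by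
    have := Lagrange.nodal_monic (s := Finset.univ) (v := x)
    rw [Polynomial.Monic, Polynomial.leadingCoeff, Lagrange.natDegree_nodal] at this
    simpa using this
  rw [hc, one_mul] at h
  rw [← h, altSum_snoc, Finset.sum_eq_zero, zero_add, mul_comm]
  · simp [Lagrange.eval_nodal]
  · intro i _
    have : (Lagrange.nodal Finset.univ x).eval (x i) = 0 :=
      Lagrange.eval_nodal_at_node (Finset.mem_univ i)
    simp [this]

theorem injective_snoc {α : Type*} {k : ℕ} {x : Fin k → α} (hx : Function.Injective x) {y : α}
    (hy : ∀ i, x i ≠ y) : Function.Injective (Fin.snoc x y : Fin (k + 1) → α) := by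
  intro i j
  refine Fin.lastCases ?_ (fun i => ?_) i <;> refine Fin.lastCases ?_ (fun j => ?_) j
  · simp
  · simp only [Fin.snoc_last, Fin.snoc_castSucc]
    exact fun h => absurd h.symm (hy j)
  · simp only [Fin.snoc_last, Fin.snoc_castSucc]
    exact fun h => absurd h (hy i)
  · simp only [Fin.snoc_castSucc]
    exact fun h => by rw [hx h]

theorem forall_snoc {α : Type*} {k : ℕ} {x : Fin k → α} {y : α} {P : α → Prop}
    (hx : ∀ i, P (x i)) (hy : P y) : ∀ i, P ((Fin.snoc x y : Fin (k + 1) → α) i) := by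
  intro i
  refine Fin.lastCases ?_ (fun i => ?_) i
  · simpa using hy
  · simpa using hx i

theorem altSum_polynomial_eq_zero {k : ℕ} (v : Fin (k + 1) → ℝ) {p : Polynomial ℝ}
    (hp : p.degree < k) : altSum v (fun i => p.eval (v i)) = 0 := by
  rw [altSum_polynomial v (Polynomial.natDegree_le_of_degree_le hp.le),
    Polynomial.coeff_eq_zero_of_degree_lt hp, zero_mul]

/-- A polynomial of degree `< k` taking integer values at `k` distinct integers takes values in
`V⁻¹ ℤ` at all integers, `V` being the Vandermonde determinant of the `k` integers. -/
theorem exists_int_vand_mul_eval {k : ℕ} (x : Fin k → ℤ) {p : Polynomial ℝ} (hp : p.degree < k)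
    (m : ℤ → ℤ) (hm : ∀ i, p.eval (x i : ℝ) = m (x i)) (n : ℤ) :
    ∃ z : ℤ, vand (fun i => (x i : ℝ)) * p.eval (n : ℝ) = z := by
  have h := altSum_polynomial_eq_zero (Fin.snoc (fun i => (x i : ℝ)) (n : ℝ)) hp
  rw [altSum_snoc] at h
  refine ⟨-∑ i : Fin k, (-1) ^ ((i : ℕ) + k) * m (x i) *
        vand (fun j => (Fin.snoc x n : Fin (k + 1) → ℤ) (i.castSucc.succAbove j)), ?_⟩
  have hs : ∀ j, (Fin.snoc (fun i => (x i : ℝ)) (n : ℝ) : Fin (k + 1) → ℝ) j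
      = (((Fin.snoc x n : Fin (k + 1) → ℤ) j : ℤ) : ℝ) := by
    intro j
    refine Fin.lastCases ?_ (fun i => ?_) j <;> simp
  simp only [hs, vand_intCast, Fin.snoc_castSucc, Fin.snoc_last, hm] at h
  rw [vand_intCast]
  push_cast
  linarith

/-! ### Rigidity of close points, and size estimates from the k-th derivative -/

/-- Integer points near a curve with small `k`-th derivative lie on a polynomial of degree
less than `k`. -/
theorem exists_polynomial_of_close {A B : ℝ} {F : ℕ → ℝ → ℝ} (hF : IsDerivTower (Icc A B) F)
    {k : ℕ} {Λ δ L : ℝ} (hΛ : ∀ x ∈ Icc A B, |F k x| ≤ Λ) (hδ : 0 ≤ δ)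
    (m : ℤ → ℤ) (S : Finset ℤ) (hS : ∀ n ∈ S, (n : ℝ) ∈ Icc A B)
    (hm : ∀ n ∈ S, |F 0 n - m n| ≤ δ) (hSL : ∀ n ∈ S, ∀ n' ∈ S, |(n : ℝ) - n'| ≤ L)
    (hsmall : Λ / k.factorial * L ^ (k + 1).choose 2 + (k + 1) * δ * L ^ k.choose 2 < 1) :
    ∃ p : Polynomial ℝ, p.degree < k ∧ ∀ n ∈ S, p.eval (n : ℝ) = m n := by
  rcases le_or_gt S.card k with hc | hc
  · have hinj : InjOn (fun n : ℤ => (n : ℝ)) S := Int.cast_injective.injOn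
    refine ⟨Lagrange.interpolate S (fun n : ℤ => (n : ℝ)) (fun n => (m n : ℝ)),
      (Lagrange.degree_interpolate_lt _ hinj).trans_le (by exact_mod_cast hc), fun n hn => ?_⟩
    exact Lagrange.eval_interpolate_at_node _ hinj hn
  · let x : Fin k → ℤ := fun i => S.orderEmbOfFin rfl (i.castLE hc.le)
    have hx : Function.Injective x := fun i j hij =>
      Fin.castLE_injective hc.le ((S.orderEmbOfFin rfl).injective hij)
    have hxS : ∀ i, x i ∈ S := fun i => S.orderEmbOfFin_mem rfl _
    have hxR : Function.Injective (fun i => (x i : ℝ)) := Int.cast_injective.comp hx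
    set p := Lagrange.interpolate Finset.univ (fun i => (x i : ℝ)) (fun i => (m (x i) : ℝ)) with hp
    have hpd : p.degree < k := by
      have h := Lagrange.degree_interpolate_lt (s := Finset.univ) (fun i => (m (x i) : ℝ))
        hxR.injOn
      rwa [Finset.card_univ, Fintype.card_fin] at h
    have hpx : ∀ i, p.eval (x i : ℝ) = m (x i) := fun i =>
      Lagrange.eval_interpolate_at_node (s := Finset.univ) (fun i => (m (x i) : ℝ)) hxR.injOn
        (Finset.mem_univ i)
    refine ⟨p, hpd, fun n hn => ?_⟩
    by_cases hnx : ∃ i, x i = n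
    · obtain ⟨i, rfl⟩ := hnx
      exact hpx i
    push Not at hnx
    set v : Fin (k + 1) → ℤ := Fin.snoc x n with hv
    have hvinj : Function.Injective v := injective_snoc hx hnx
    have hvS : ∀ i, v i ∈ S := forall_snoc (P := fun n => n ∈ S) hxS hn
    have hvL : ∀ i j, |(v i : ℝ) - v j| ≤ L := fun i j => hSL _ (hvS i) _ (hvS j)
    obtain ⟨ξ, hξ, h1⟩ := hF.altSum_eq (fun i => (v i : ℝ)) (Int.cast_injective.comp hvinj)
      (fun i => hS _ (hvS i))
    have h2 : |altSum (fun i => (v i : ℝ)) (fun i => F 0 (v i) - m (v i))|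
        ≤ (k + 1) * δ * L ^ k.choose 2 :=
      abs_altSum_le hδ hvL fun i => hm _ (hvS i)
    have h3 : |altSum (fun i => (v i : ℝ)) (fun i => F 0 (v i))|
        ≤ Λ / k.factorial * L ^ (k + 1).choose 2 := by
      rw [h1, abs_mul, abs_div, Nat.abs_cast]
      have := hΛ ξ hξ
      have hΛ0 : 0 ≤ Λ := (abs_nonneg _).trans this
      exact mul_le_mul (by gcongr) (abs_vand_le hvL) (abs_nonneg _) (by positivity)
    have h4 : altSum (fun i => (v i : ℝ)) (fun i => ((m (v i) : ℤ) : ℝ)) = 0 := by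
      have h5 : |altSum (fun i => (v i : ℝ)) (fun i => ((m (v i) : ℤ) : ℝ))| < 1 := by
        rw [altSum_sub] at h2
        refine lt_of_le_of_lt ?_ hsmall
        calc _ = |altSum (fun i => (v i : ℝ)) (fun i => F 0 (v i)) -
                (altSum (fun i => (v i : ℝ)) (fun i => F 0 (v i)) -
                altSum (fun i => (v i : ℝ)) (fun i => ((m (v i) : ℤ) : ℝ)))| := by ring_nf
          _ ≤ _ := (abs_sub _ _).trans (add_le_add h3 h2)
      rw [altSum_intCast v (fun i => m (v i))] at h5 ⊢
      have : |altSum v (fun i => m (v i))| < 1 := by exact_mod_cast h5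
      rw [Int.abs_lt_one_iff.1 this, Int.cast_zero]
    -- `p - m` vanishes at the first k nodes, so its vanishing `altSum` reduces to (p(n) - m(n))
    -- times a nonzero Vandermonde determinant.
    have h6 : altSum (fun i => (v i : ℝ)) (fun i => p.eval (v i : ℝ) - (m (v i) : ℤ)) = 0 := by
      rw [altSum_sub, h4, altSum_polynomial_eq_zero _ hpd, sub_zero]
    have hs : (fun i => (v i : ℝ)) = Fin.snoc (fun i => (x i : ℝ)) (n : ℝ) := by
      funext j
      refine Fin.lastCases ?_ (fun i => ?_) j <;> simp [hv]
    rw [hs, altSum_snoc, Finset.sum_eq_zero, zero_add] at h6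
    · rcases mul_eq_zero.1 h6 with h | h
      · simpa [hv, sub_eq_zero] using h
      · exact absurd h (vand_ne_zero hxR)
    · intro i _
      simp [hv, hpx]

/-- Needed both for k + 1 and for k nodes at spacing ℓ/k; the latter need not reach the right end
point. -/
theorem evenly_spaced {k : ℕ} {a ℓ : ℝ} (hℓ : 0 ≤ ℓ) (s : ℕ) (hks : k ≤ s + 1) (hs : 0 < s) :
    (∀ i : Fin k, a + i * (ℓ / s) ∈ Icc a (a + ℓ)) ∧
      ∀ i j : Fin k, i ≠ j → ℓ / s ≤ |(a + i * (ℓ / s)) - (a + j * (ℓ / s))| := by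
  constructor
  · intro i
    have hi : ((i : ℕ) : ℝ) ≤ s := by
      have := i.2
      exact_mod_cast (by omega : (i : ℕ) ≤ s)
    have hs' : (0 : ℝ) < s := by exact_mod_cast hs
    refine ⟨by have : 0 ≤ (i : ℝ) * (ℓ / s) := by positivity
               linarith, ?_⟩
    have : (i : ℝ) * (ℓ / s) ≤ s * (ℓ / s) := by gcongr
    rw [mul_div_cancel₀ _ hs'.ne'] at this
    linarith
  · intro i j hij
    have h1 : (a + i * (ℓ / s)) - (a + j * (ℓ / s)) = (((i : ℕ) : ℤ) - ((j : ℕ) : ℤ) : ℤ) * (ℓ / s) := by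
      push_cast; ring
    rw [h1, abs_mul, abs_of_nonneg (div_nonneg hℓ (Nat.cast_nonneg s)), ← Int.cast_abs]
    have h2 : (1 : ℤ) ≤ |((i : ℕ) : ℤ) - ((j : ℕ) : ℤ)| := by
      apply Int.one_le_abs
      intro h
      exact hij (Fin.ext (by omega))
    have h3 : (1 : ℝ) ≤ ((|((i : ℕ) : ℤ) - ((j : ℕ) : ℤ)| : ℤ) : ℝ) := by exact_mod_cast h2
    have := div_nonneg hℓ (Nat.cast_nonneg (α := ℝ) s)
    nlinarith

/-- A function which is small on an interval of length `ℓ` and whose `k`-th derivative is large: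
the interval is short. -/
theorem IsDerivTower.length_le {A B : ℝ} {G : ℕ → ℝ → ℝ} (hG : IsDerivTower (Icc A B) G)
    {k : ℕ} (hk : 0 < k) {lam δ : ℝ} (hlam : ∀ x ∈ Icc A B, lam ≤ |G k x|)
    (hδ : 0 ≤ δ)
    {a ℓ : ℝ} (hℓ : 0 < ℓ) (ha : A ≤ a) (hb : a + ℓ ≤ B)
    (hsm : ∀ x ∈ Icc a (a + ℓ), |G 0 x| ≤ δ) :
    lam * ℓ ^ k ≤ (k.factorial * (k + 1) * k ^ (k + 1).choose 2) * δ := by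
  obtain ⟨hv, hsep⟩ := evenly_spaced (k := k + 1) (a := a) hℓ.le k le_rfl hk
  set v : Fin (k + 1) → ℝ := fun i => a + i * (ℓ / k) with hvdef
  have hk' : (0 : ℝ) < k := by exact_mod_cast hk
  have hinj : Function.Injective v := by
    intro i j hij
    by_contra hne
    have := hsep i j hne
    have h0 : 0 < ℓ / k := by positivity
    simp only [hvdef] at hij
    rw [hij, sub_self, abs_zero] at this
    linarith
  obtain ⟨ξ, hξ, h1⟩ := hG.altSum_eq v hinj fun i => ⟨ha.trans (hv i).1, (hv i).2.trans hb⟩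
  have h2 : |altSum v (fun i => G 0 (v i))| ≤ (k + 1) * δ * ℓ ^ k.choose 2 :=
    abs_altSum_le hδ (fun i j => by
      rw [abs_le]
      constructor <;> linarith [(hv i).1, (hv i).2, (hv j).1, (hv j).2]) fun i => hsm _ (hv i)
  have h3 : (ℓ / k) ^ (k + 1).choose 2 ≤ |vand v| := le_abs_vand (by positivity) hsep
  rw [h1, abs_mul, abs_div, Nat.abs_cast] at h2
  have h4 : lam / k.factorial * (ℓ / k) ^ (k + 1).choose 2 ≤ (k + 1) * δ * ℓ ^ k.choose 2 := by
    refine le_trans ?_ h2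
    have := hlam ξ hξ
    gcongr
  have h5 : (k + 1).choose 2 = k + k.choose 2 := by
    rw [Nat.choose_succ_succ' k 1, Nat.choose_one_right]
  have hf : (0 : ℝ) < k.factorial := by positivity
  rw [div_pow, div_mul_div_comm, div_le_iff₀ (by positivity)] at h4
  refine le_of_mul_le_mul_right ?_ (show 0 < ℓ ^ k.choose 2 by positivity)
  calc lam * ℓ ^ k * ℓ ^ k.choose 2 = lam * ℓ ^ (k + 1).choose 2 := by rw [h5]; ring
    _ ≤ _ := h4
    _ = _ := by ring

/-- A function which is small on an interval of length `ℓ` and has a bounded `k`-th derivative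
grows slowly away from the interval. -/
theorem IsDerivTower.abs_le {A B : ℝ} {G : ℕ → ℝ → ℝ} (hG : IsDerivTower (Icc A B) G)
    {k : ℕ} (hk : 0 < k) {Λ δ : ℝ} (hΛ : ∀ x ∈ Icc A B, |G k x| ≤ Λ) (hδ : 0 ≤ δ)
    {a ℓ : ℝ} (hℓ : 0 < ℓ) (ha : A ≤ a) (hb : a + ℓ ≤ B)
    (hsm : ∀ x ∈ Icc a (a + ℓ), |G 0 x| ≤ δ) {D : ℝ} (hD : 1 ≤ D) {y : ℝ} (hy : y ∈ Icc A B)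
    (hyD : y ∈ Icc (a + ℓ - D * ℓ) (a + D * ℓ)) :
    |G 0 y| ≤ Λ / k.factorial * (D * ℓ) ^ k + (k + 1) * δ * (D * k) ^ k.choose 2 := by
  have hΛ0 : 0 ≤ Λ := (abs_nonneg _).trans (hΛ y hy)
  have hk1 : (1 : ℝ) ≤ k := by exact_mod_cast hk
  have hDℓ : ℓ ≤ D * ℓ := by nlinarith
  -- Inside the interval the claim is immediate; outside it, `y` differs from all the nodes and can
  -- serve as the extra one.
  by_cases hya : y ∈ Icc a (a + ℓ)
  · refine (hsm y hya).trans ?_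
    have h1 : (1 : ℝ) ≤ (D * k) ^ k.choose 2 := one_le_pow₀ (by nlinarith)
    have h2 : 0 ≤ Λ / k.factorial * (D * ℓ) ^ k := by positivity
    have h3 : (1 : ℝ) * δ * 1 ≤ (k + 1) * δ * (D * k) ^ k.choose 2 := by
      gcongr; linarith
    linarith
  obtain ⟨hv, hsep⟩ := evenly_spaced (k := k) (a := a) hℓ.le k (Nat.le_succ k) hk
  set x : Fin k → ℝ := fun i => a + i * (ℓ / k) with hxdef
  have hinj : Function.Injective x := by
    intro i j hij
    by_contra hne
    have := hsep i j hne
    have h0 : 0 < ℓ / k := by positivity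
    simp only [hxdef] at hij
    rw [hij, sub_self, abs_zero] at this
    linarith
  set v : Fin (k + 1) → ℝ := Fin.snoc x y with hvdef
  have hvinj : Function.Injective v :=
    injective_snoc hinj fun i h => hya (h ▸ hv i)
  obtain ⟨ξ, hξ, h1⟩ := hG.altSum_eq v hvinj
    (forall_snoc (P := fun z => z ∈ Icc A B) (fun i => ⟨ha.trans (hv i).1, (hv i).2.trans hb⟩) hy)
  have hxy : ∀ i, |y - x i| ≤ D * ℓ := by
    intro i
    rw [_root_.abs_le]
    constructor <;> linarith [(hv i).1, (hv i).2, hyD.1, hyD.2]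
  have hxx : ∀ i j, |x i - x j| ≤ D * ℓ := by
    intro i j
    rw [_root_.abs_le]
    constructor <;> linarith [(hv i).1, (hv i).2, (hv j).1, (hv j).2]
  have hvv : ∀ i j, |v i - v j| ≤ D * ℓ := by
    have h0 : ∀ z, z = y ∨ (∃ i, z = x i) → |z - y| ≤ D * ℓ ∧ ∀ j, |z - x j| ≤ D * ℓ := by
      rintro z (rfl | ⟨i, rfl⟩)
      · exact ⟨by simp; linarith, hxy⟩
      · exact ⟨by rw [abs_sub_comm]; exact hxy i, hxx i⟩
    intro i
    have := h0 (v i) (forall_snoc (P := fun z => z = y ∨ ∃ i, z = x i)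
      (fun i => Or.inr ⟨i, rfl⟩) (Or.inl rfl) i)
    exact forall_snoc (P := fun z => |v i - z| ≤ D * ℓ) this.2 this.1
  have hV : (ℓ / k) ^ k.choose 2 ≤ |vand x| := le_abs_vand (by positivity) hsep
  have hVpos : 0 < |vand x| := abs_pos.2 (vand_ne_zero hinj)
  rw [altSum_snoc] at h1
  have h2 : |∑ i : Fin k, (-1) ^ ((i : ℕ) + k) * G 0 (v i.castSucc) *
      vand (fun j => v (i.castSucc.succAbove j))| ≤ (k + 1) * δ * (D * ℓ) ^ k.choose 2 := by
    refine (Finset.abs_sum_le_sum_abs _ _).trans ?_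
    calc _ ≤ ∑ _i : Fin k, δ * (D * ℓ) ^ k.choose 2 := by
          refine Finset.sum_le_sum fun i _ => ?_
          rw [abs_mul, abs_mul, abs_pow, abs_neg, abs_one, one_pow, one_mul]
          refine mul_le_mul ?_ (abs_vand_le fun _ _ => hvv _ _) (abs_nonneg _) hδ
          rw [hvdef, Fin.snoc_castSucc]
          exact hsm _ (hv i)
      _ = k * δ * (D * ℓ) ^ k.choose 2 := by simp; ring
      _ ≤ _ := by gcongr; linarith
  have h3 : |G k ξ / k.factorial * vand v| ≤ Λ / k.factorial * (D * ℓ) ^ k * |vand x| := by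
    rw [hvdef, vand_snoc, abs_mul, abs_mul, abs_div, Nat.abs_cast, Finset.abs_prod]
    have h4 : ∏ i, |y - x i| ≤ (D * ℓ) ^ k := by
      calc _ ≤ ∏ _i : Fin k, D * ℓ := Finset.prod_le_prod (fun _ _ => abs_nonneg _) fun i _ => hxy i
        _ = _ := by simp
    have := hΛ ξ hξ
    calc |G k ξ| / k.factorial * (|vand x| * ∏ i, |y - x i|)
        ≤ Λ / k.factorial * (|vand x| * (D * ℓ) ^ k) := by gcongr
      _ = _ := by ring
  have h5 : |G 0 y| * |vand x| ≤ Λ / k.factorial * (D * ℓ) ^ k * |vand x| +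
      (k + 1) * δ * (D * ℓ) ^ k.choose 2 := by
    rw [← abs_mul]
    have h6 : G 0 y * vand x = G k ξ / k.factorial * vand v -
        ∑ i : Fin k, (-1) ^ ((i : ℕ) + k) * G 0 (v i.castSucc) *
          vand (fun j => v (i.castSucc.succAbove j)) := by
      rw [← h1]; simp [hvdef]
    rw [h6]
    exact (abs_sub _ _).trans (add_le_add h3 h2)
  have h7 : (D * ℓ) ^ k.choose 2 ≤ (D * k) ^ k.choose 2 * |vand x| := by
    have : D * ℓ = D * k * (ℓ / k) := by field_simp
    rw [this, mul_pow]
    gcongr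
  refine le_of_mul_le_mul_right (h5.trans ?_) hVpos
  refine le_trans (add_le_add le_rfl ?_) (add_mul _ _ _).ge
  calc (k + 1) * δ * (D * ℓ) ^ k.choose 2
      ≤ (k + 1) * δ * ((D * k) ^ k.choose 2 * |vand x|) := by gcongr
    _ = _ := by ring

/-- A maximum of at least δ would be interior, hence a critical point. -/
theorem lt_of_no_critical_point {g g' : ℝ → ℝ} {s t δ : ℝ} (hst : s < t)
    (hc : ContinuousOn g (Icc s t)) (hd : ∀ x ∈ Ioo s t, HasDerivAt g (g' x) x)
    (h0 : ∀ x ∈ Ioo s t, g' x ≠ 0) (hs : g s < δ) (ht : g t < δ) :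
    ∀ x ∈ Icc s t, g x < δ := by
  obtain ⟨y, hy, hmax⟩ := isCompact_Icc.exists_isMaxOn (nonempty_Icc.2 hst.le) hc
  suffices g y < δ from fun x hx => (hmax hx).trans_lt this
  by_contra hge
  push Not at hge
  have hy' : y ∈ Ioo s t := by
    refine ⟨lt_of_le_of_ne hy.1 ?_, lt_of_le_of_ne hy.2 ?_⟩
    · rintro rfl; linarith
    · rintro rfl; linarith
  have hloc : IsLocalMax g y := hmax.isLocalMax (Icc_mem_nhds hy'.1 hy'.2)
  exact h0 y hy' (hloc.hasDerivAt_eq_zero (hd y hy'))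

/-- If the `k`-th derivative does not vanish, the interval splits into `k` classes of points
such that smallness at two points of the same class propagates to all points in between. -/
theorem IsDerivTower.exists_class {A B : ℝ} {G : ℕ → ℝ → ℝ} (hG : IsDerivTower (Icc A B) G)
    {k : ℕ} (hk : 0 < k) (h0 : ∀ x ∈ Icc A B, G k x ≠ 0) :
    ∃ cls : ℝ → Fin k, ∀ δ : ℝ, ∀ s ∈ Icc A B, ∀ t ∈ Icc A B, s ≤ t → cls s = cls t →
      |G 0 s| < δ → |G 0 t| < δ → ∀ x ∈ Icc s t, |G 0 x| < δ := by
  classical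
  obtain ⟨j, rfl⟩ : ∃ j, k = j + 1 := ⟨k - 1, by omega⟩
  have hcard : ∀ Z : Finset ℝ, (∀ z ∈ Z, z ∈ Icc A B ∧ G 1 z = 0) → Z.card ≤ j := by
    intro Z hZ
    by_contra hlt
    push Not at hlt
    obtain ⟨ξ, hξ, hz⟩ := hG.shift.exists_zero (k := j) Z hlt (fun z hz => (hZ z hz).1)
      (fun z hz => (hZ z hz).2)
    exact h0 ξ hξ hz
  have hfin : {z | z ∈ Icc A B ∧ G 1 z = 0}.Finite := by
    by_contra hinf
    obtain ⟨Z, hZ, hZc⟩ := Set.Infinite.exists_subset_card_eq hinf (j + 1)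
    have := hcard Z fun z hz => hZ hz
    omega
  set Z := hfin.toFinset with hZdef
  have hZ : ∀ z, z ∈ Z ↔ z ∈ Icc A B ∧ G 1 z = 0 := fun z => by simp [hZdef]
  -- The class of `s` counts the zeros of `G 1` to the left of `s`; there are at most k - 1, so k
  -- values suffice.
  refine ⟨fun s => ⟨(Z.filter (· < s)).card, Nat.lt_succ_of_le
    ((Finset.card_filter_le _ _).trans (hcard Z fun z hz => (hZ z).1 hz))⟩, ?_⟩
  intro δ s hs t ht hst hcls hδs hδt
  rcases hst.eq_or_lt with rfl | hst
  · intro x hx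
    rwa [le_antisymm hx.2 hx.1]
  have hsub : Icc s t ⊆ Icc A B := Icc_subset_Icc hs.1 ht.2
  have hno : ∀ x ∈ Ioo s t, G 1 x ≠ 0 := by
    intro x hx hx0
    have h1 : Z.filter (· < s) ⊂ Z.filter (· < t) := by
      refine Finset.ssubset_iff_subset_ne.2 ⟨fun z hz => ?_, fun he => ?_⟩
      · rw [Finset.mem_filter] at hz ⊢
        exact ⟨hz.1, hz.2.trans hst⟩
      · have : x ∈ Z.filter (· < t) :=
          Finset.mem_filter.2 ⟨(hZ x).2 ⟨hsub (Ioo_subset_Icc_self hx), hx0⟩, hx.2⟩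
        rw [← he, Finset.mem_filter] at this
        exact absurd this.2 (not_lt.2 hx.1.le)
    have h2 := Finset.card_lt_card h1
    have h3 := congrArg Fin.val hcls
    simp only at h3
    omega
  have hc := (hG.mono hsub).continuousOn 0
  have hd : ∀ x ∈ Ioo s t, HasDerivAt (G 0) (G 1 x) x := fun x hx => (hG.mono hsub).hasDerivAt 0 hx
  intro x hx
  rw [abs_lt] at hδs hδt ⊢
  refine ⟨?_, lt_of_no_critical_point hst hc hd hno hδs.2 hδt.2 x hx⟩
  have := lt_of_no_critical_point (g := fun x => -G 0 x) (g' := fun x => -G 1 x) (δ := δ) hst hc.neg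
    (fun x hx => (hd x hx).neg) (fun x hx => neg_ne_zero.2 (hno x hx)) (by linarith) (by linarith)
    x hx
  linarith

/-! ### Combinatorics of integers and intervals -/

/-- Among many integers in an interval there are `k` close together. -/
theorem exists_cluster {k : ℕ} (hk : 0 < k) (T : Finset ℤ) {a h : ℝ} (hh : 0 < h)
    (hT : ∀ n ∈ T, (n : ℝ) ∈ Icc a (a + h)) (hcard : k * k ≤ T.card) :
    ∃ x : Fin k → ℤ, Function.Injective x ∧ (∀ i, x i ∈ T) ∧
      ∀ i j, |(x i : ℝ) - x j| ≤ 2 * k * h / T.card := by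
  set r := T.card / k with hr
  have hrk : k ≤ r := (Nat.le_div_iff_mul_le hk).2 hcard
  have hr0 : 0 < r := hk.trans_le hrk
  have hrk2 : r * k ≤ T.card := Nat.div_mul_le_self _ _
  have hr0' : (0 : ℝ) < r := by exact_mod_cast hr0
  -- Cells have length h/r, and cell r receives only the right end point. Since r ≥ k, (r + 1)(k -
  -- 1) < rk, so some cell holds k points.
  have hlt : (Finset.range (r + 1)).card * (k - 1) < T.card := by
    rw [Finset.card_range]
    obtain ⟨j, rfl⟩ : ∃ j, k = j + 1 := ⟨k - 1, by omega⟩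
    simp only [Nat.add_sub_cancel]
    nlinarith
  obtain ⟨y, _, hy⟩ := Finset.exists_lt_card_fiber_of_mul_lt_card_of_maps_to
    (f := fun n : ℤ => ⌊((n : ℝ) - a) * r / h⌋₊) (s := T) (t := Finset.range (r + 1)) (by
      intro n hn
      rw [Finset.mem_range, Nat.lt_succ_iff]
      apply Nat.floor_le_of_le
      rw [div_le_iff₀ hh, mul_comm]
      have := (hT n hn).2
      gcongr
      linarith) hlt
  set U := T.filter (fun n : ℤ => ⌊((n : ℝ) - a) * r / h⌋₊ = y) with hU
  have hUc : k ≤ U.card := by omega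
  refine ⟨fun i => U.orderEmbOfFin rfl (i.castLE hUc), fun i j hij =>
    Fin.castLE_injective hUc ((U.orderEmbOfFin rfl).injective hij), fun i => ?_, fun i j => ?_⟩
  · exact (Finset.mem_filter.1 (U.orderEmbOfFin_mem rfl (i.castLE hUc))).1
  have h1 := Finset.mem_filter.1 (U.orderEmbOfFin_mem rfl (i.castLE hUc))
  have h2 := Finset.mem_filter.1 (U.orderEmbOfFin_mem rfl (j.castLE hUc))
  set n := U.orderEmbOfFin rfl (i.castLE hUc)
  set n' := U.orderEmbOfFin rfl (j.castLE hUc)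
  have hfl : ∀ n : ℤ, n ∈ T → ⌊((n : ℝ) - a) * r / h⌋₊ = y →
      (y : ℝ) ≤ ((n : ℝ) - a) * r / h ∧ ((n : ℝ) - a) * r / h < y + 1 := by
    intro n hn hy
    have : 0 ≤ ((n : ℝ) - a) * r / h := by
      have := (hT n hn).1
      have : 0 ≤ (n : ℝ) - a := by linarith
      positivity
    exact (Nat.floor_eq_iff this).1 hy
  obtain ⟨l1, u1⟩ := hfl n h1.1 h1.2
  obtain ⟨l2, u2⟩ := hfl n' h2.1 h2.2
  have h3 : |(n : ℝ) - n'| * (r / h) ≤ 1 := by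
    rw [← abs_of_pos (show (0 : ℝ) < r / h by positivity), ← abs_mul, abs_le]
    have e : ((n : ℝ) - n') * (r / h) = (n - a) * r / h - (n' - a) * r / h := by ring
    rw [e]
    constructor <;> linarith
  have h4 : (T.card : ℝ) ≤ 2 * k * r := by
    have : T.card < (r + 1) * k := by
      rw [hr]
      exact Nat.lt_mul_of_div_lt (Nat.lt_succ_self _) hk
    have h5 : (r + 1) * k ≤ 2 * k * r := by nlinarith
    exact_mod_cast this.le.trans h5
  have hT0 : (0 : ℝ) < T.card := by
    exact_mod_cast (Nat.mul_pos hr0 hk).trans_le hrk2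
  rw [le_div_iff₀ hT0]
  have h5 : |(n : ℝ) - n'| * r ≤ h := by
    rw [← mul_div_assoc, div_le_iff₀ hh, one_mul] at h3
    exact h3
  calc |(n : ℝ) - n'| * T.card ≤ |(n : ℝ) - n'| * (2 * k * r) := by gcongr
    _ = 2 * k * (|(n : ℝ) - n'| * r) := by ring
    _ ≤ _ := by gcongr

/-- Integers with gaps at least `d` in an interval of length `D`. -/
theorem card_le_of_spaced (T : Finset ℤ) {d D : ℝ} (hd : 0 < d) (hD : 0 ≤ D)
    (hsep : ∀ n ∈ T, ∀ n' ∈ T, n < n' → d ≤ (n' : ℝ) - n)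
    (hdiam : ∀ n ∈ T, ∀ n' ∈ T, n < n' → (n' : ℝ) - n ≤ D) :
    (T.card : ℝ) ≤ D / d + 1 := by
  rcases T.eq_empty_or_nonempty with rfl | hne
  · simp; positivity
  set a := T.min' hne with ha
  have hnn : ∀ n ∈ T, 0 ≤ ((n : ℝ) - a) / d := fun n hn => by
    have : (a : ℝ) ≤ n := by exact_mod_cast T.min'_le n hn
    have : 0 ≤ (n : ℝ) - a := by linarith
    positivity
  have h1 : T.card ≤ (Finset.range (⌊D / d⌋₊ + 1)).card := by
    refine Finset.card_le_card_of_injOn (fun n : ℤ => ⌊((n : ℝ) - a) / d⌋₊) ?_ ?_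
    · intro n hn
      simp only [Finset.coe_range, mem_Iio, Nat.lt_succ_iff]
      refine Nat.floor_le_floor ?_
      gcongr
      rcases (T.min'_le n hn).eq_or_lt with h | h
      · rw [ha, h]; simpa using hD
      · exact hdiam _ (T.min'_mem hne) _ hn h
    · have key : ∀ n ∈ T, ∀ n' ∈ T, n < n' →
          ⌊((n : ℝ) - a) / d⌋₊ ≠ ⌊((n' : ℝ) - a) / d⌋₊ := by
        intro n hn n' hn' hlt he
        have h2 := hsep n hn n' hn' hlt
        have h3 : ((n : ℝ) - a) / d + 1 ≤ ((n' : ℝ) - a) / d := by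
          rw [div_add_one hd.ne']
          gcongr
          linarith
        have h4 := Nat.floor_le_floor h3
        rw [Nat.floor_add_one (hnn n hn)] at h4
        omega
      intro n hn n' hn' he
      rcases lt_trichotomy n n' with h | h | h
      · exact absurd he (key n hn n' hn' h)
      · exact h
      · exact absurd he.symm (key n' hn' n hn h)
  rw [Finset.card_range] at h1
  calc (T.card : ℝ) ≤ (⌊D / d⌋₊ : ℝ) + 1 := by exact_mod_cast h1
    _ ≤ _ := by gcongr; exact Nat.floor_le (by positivity)

/-- Intervals none of which lies in the enlargement of another one: all but one of the enlargements
have a bounded total length. -/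
theorem sum_radius_le {ι : Type*} [DecidableEq ι] (s : Finset ι) (hs : s.Nonempty) {A B : ℝ}
    (a b r : ι → ℝ) (ha : ∀ i ∈ s, A ≤ a i) (hab : ∀ i ∈ s, a i ≤ b i) (hb : ∀ i ∈ s, a i ≤ B)
    (hr : ∀ i ∈ s, b i - a i ≤ r i)
    (hnn : ∀ i ∈ s, ∀ j ∈ s, i ≠ j → ¬ (a i - r i ≤ a j ∧ b j ≤ b i + r i)) :
    ∃ i ∈ s, ∑ j ∈ s.erase i, r j ≤ 2 * (B - A) := by
  -- The omitted index is the rightmost one; bounding the sum by 2(a i - A) makes the induction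
  -- telescope.
  suffices h : ∃ i ∈ s, (∀ j ∈ s, a j ≤ a i) ∧ ∑ j ∈ s.erase i, r j ≤ 2 * (a i - A) by
    obtain ⟨i, hi, _, h⟩ := h
    exact ⟨i, hi, h.trans (by linarith [hb i hi])⟩
  -- If r i were larger, interval j would have to stick out beyond b i + r i. It would then be so
  -- long that its own enlargement contains interval i.
  have hsep : ∀ i ∈ s, ∀ j ∈ s, i ≠ j → a i ≤ a j → r i ≤ 2 * (a j - a i) := by
    intro i hi j hj hij hle
    by_contra hlt
    push Not at hlt
    have h1 := hnn i hi j hj hij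
    have h2 := hnn j hj i hi hij.symm
    have := hr i hi; have := hr j hj; have := hab i hi; have := hab j hj
    have h3 : b i + r i < b j := by
      by_contra h
      exact h1 ⟨by linarith, by linarith⟩
    exact h2 ⟨by linarith, by linarith⟩
  clear hnn hb hr hab
  induction s using Finset.induction_on_max_value a with
  | empty => exact absurd hs Finset.not_nonempty_empty
  | insert x s hx hmax ih =>
    rcases s.eq_empty_or_nonempty with rfl | hne
    · exact ⟨x, by simp, by simp, by simpa using ha x (by simp)⟩
    obtain ⟨i, hi, him, hsum⟩ := ih hne (fun i hi => ha i (Finset.mem_insert_of_mem hi))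
      (fun i hi j hj => hsep i (Finset.mem_insert_of_mem hi) j (Finset.mem_insert_of_mem hj))
    refine ⟨x, Finset.mem_insert_self _ _, ?_, ?_⟩
    · intro j hj
      rcases Finset.mem_insert.1 hj with rfl | hj
      · exact le_rfl
      · exact hmax j hj
    · rw [Finset.erase_insert hx, ← Finset.add_sum_erase s r hi]
      have := hsep i (Finset.mem_insert_of_mem hi) x (Finset.mem_insert_self _ _)
        (fun h => hx (h ▸ hi)) (hmax i hi)
      linarith

/-! ### Arcs and their isolation -/

/-- The constant in the bound for the length of an interval on which a function is small. -/
noncomputable def lengthConst (k : ℕ) : ℝ := k.factorial * (k + 1) * k ^ (k + 1).choose 2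

theorem one_le_lengthConst {k : ℕ} (hk : 0 < k) : 1 ≤ lengthConst k := by
  have h1 : (1 : ℝ) ≤ k.factorial := by exact_mod_cast Nat.succ_le_of_lt k.factorial_pos
  have h2 : (1 : ℝ) ≤ k := by exact_mod_cast hk
  have h3 : (1 : ℝ) ≤ (k : ℝ) ^ (k + 1).choose 2 := one_le_pow₀ h2
  unfold lengthConst
  have h4 : (1 : ℝ) ≤ k.factorial * (k + 1) := by nlinarith
  nlinarith

/-- The constant in the bound for a function near an interval on which it is small. -/
noncomputable def growthConst (k : ℕ) (κ : ℝ) : ℝ :=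
  κ * lengthConst k * 2 ^ k.choose 2 + (k + 1) * (2 * k) ^ k.choose 2 + 1

theorem growthConst_pos {k : ℕ} (hk : 0 < k) {κ : ℝ} (hκ : 0 ≤ κ) : 0 < growthConst k κ := by
  have := one_le_lengthConst hk
  unfold growthConst
  positivity

/-- The factor governing the size of the neighbourhood of an arc that no other arc meets. -/
noncomputable def isolationConst (k : ℕ) (κ : ℝ) : ℝ := (2 * k * (growthConst k κ + 1))⁻¹

theorem isolationConst_pos {k : ℕ} (hk : 0 < k) {κ : ℝ} (hκ : 0 ≤ κ) : 0 < isolationConst k κ := by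
  have := growthConst_pos hk hκ
  unfold isolationConst
  positivity

/-- This is where k ≥ 3 matters: growth of order D^k must be absorbed by the Vandermonde exponent
k(k-1)/2. -/
theorem le_choose_two {k : ℕ} (hk : 3 ≤ k) : k ≤ k.choose 2 := by
  obtain ⟨j, rfl⟩ : ∃ j, k = j + 3 := ⟨k - 3, by omega⟩
  rw [Nat.choose_two_right, Nat.le_div_iff_mul_le (by norm_num)]
  simp only [Nat.add_succ_sub_one]
  nlinarith

/-- Close integer points in a wide neighbourhood of a dense arc lie on the polynomial of the arc. -/
theorem eval_eq_of_near_arc {A B : ℝ} {F : ℕ → ℝ → ℝ} (hF : IsDerivTower (Icc A B) F)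
    {k : ℕ} (hk : 3 ≤ k) {lam κ δ L : ℝ} (hκ : 0 ≤ κ)
    (hlam : ∀ x ∈ Icc A B, lam ≤ |F k x| ∧ |F k x| ≤ κ * lam)
    (hδ : 0 ≤ δ) (hL : 0 < L) (hδL : δ * L ^ k.choose 2 ≤ 1) {p : Polynomial ℝ}
    (hp : p.degree < k) (m : ℤ → ℤ) {a ℓ : ℝ} (hℓ : 0 < ℓ) (ha : A ≤ a) (hb : a + ℓ ≤ B)
    (hsm : ∀ x ∈ Icc a (a + ℓ), |F 0 x - p.eval x| ≤ δ) (T : Finset ℤ) {a' h : ℝ} (hh : 0 < h)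
    (hT : ∀ n ∈ T, (n : ℝ) ∈ Icc a' (a' + h)) (hTm : ∀ n ∈ T, p.eval (n : ℝ) = m n)
    (hcard : k * k ≤ T.card) {D : ℝ} (hD : D = isolationConst k κ * T.card * L / h) (hD1 : 1 ≤ D)
    {n : ℤ} (hnAB : (n : ℝ) ∈ Icc A B) (hnm : |F 0 n - m n| ≤ δ)
    (hn : (n : ℝ) ∈ Icc (a - D * ℓ) (a + ℓ + D * ℓ)) : p.eval (n : ℝ) = m n := by
  have hk0 : 0 < k := by omega
  have hG := hF.sub (isDerivTower_polyTower (Icc A B) p)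
  have hGk : ∀ x, F k x - polyTower p k x = F k x := fun x => by
    rw [polyTower_eq_zero hp, sub_zero]
  have hlen : lam * ℓ ^ k ≤ lengthConst k * δ :=
    hG.length_le hk0 (fun x hx => by rw [hGk]; exact (hlam x hx).1) hδ hℓ ha hb hsm
  -- The factor 2D covers the enlargement by Dℓ on both sides, because D ≥ 1.
  have hgr := hG.abs_le hk0 (Λ := κ * lam) (fun x hx => by rw [hGk]; exact (hlam x hx).2)
    hδ hℓ ha hb hsm (D := 2 * D) (by linarith) hnAB
    ⟨by nlinarith [hn.1], by nlinarith [hn.2]⟩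
  set e := k.choose 2 with he
  have hke : k ≤ e := le_choose_two hk
  have hD0 : 0 < D := by linarith
  have hbound : |(m n : ℝ) - p.eval (n : ℝ)| ≤ growthConst k κ * δ * D ^ e := by
    have h1 : κ * lam / k.factorial * (2 * D * ℓ) ^ k ≤ κ * lengthConst k * 2 ^ e * δ * D ^ e := by
      have hf : (1 : ℝ) ≤ k.factorial := by exact_mod_cast Nat.succ_le_of_lt k.factorial_pos
      have h2 : (2 * D) ^ k ≤ (2 * D) ^ e := pow_le_pow_right₀ (by linarith) hke
      have hlc := one_le_lengthConst hk0
      have h0 : 0 ≤ κ * (lengthConst k * δ) := by positivity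
      calc κ * lam / k.factorial * (2 * D * ℓ) ^ k
          = κ * (lam * ℓ ^ k) / k.factorial * (2 * D) ^ k := by ring
        _ ≤ κ * (lengthConst k * δ) / k.factorial * (2 * D) ^ e := by gcongr
        _ ≤ κ * (lengthConst k * δ) * (2 * D) ^ e := by
            gcongr; exact div_le_self h0 hf
        _ = _ := by ring
    have h3 : δ * 1 ≤ δ * D ^ e := by gcongr; exact one_le_pow₀ hD1
    have h4 : |(m n : ℝ) - p.eval (n : ℝ)| ≤ |F 0 n - m n| + |F 0 n - p.eval (n : ℝ)| := by
      have := abs_sub (F 0 n - p.eval (n : ℝ)) (F 0 n - m n)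
      calc _ = |(F 0 n - p.eval (n : ℝ)) - (F 0 n - m n)| := by ring_nf
        _ ≤ _ := this
        _ = _ := add_comm _ _
    have h5 : |F 0 n - p.eval (n : ℝ)| ≤ κ * lam / k.factorial * (2 * D * ℓ) ^ k +
      (k + 1) * δ * (2 * D * k) ^ e := hgr
    calc _ ≤ δ * D ^ e + (κ * lengthConst k * 2 ^ e * δ * D ^ e +
          (k + 1) * δ * (2 * D * k) ^ e) := by linarith
      _ = _ := by rw [growthConst, ← he]; ring
  obtain ⟨x, hxinj, hxT, hxd⟩ := exists_cluster hk0 T hh hT hcard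
  obtain ⟨z, hz⟩ := exists_int_vand_mul_eval x hp m (fun i => hTm _ (hxT i)) n
  have hv := abs_vand_le hxd
  rw [← he] at hv
  have hV0 : vand (fun i => (x i : ℝ)) ≠ 0 := vand_ne_zero (Int.cast_injective.comp hxinj)
  have hT0 : (0 : ℝ) < T.card := by
    have : 0 < T.card := lt_of_lt_of_le (by positivity) hcard
    exact_mod_cast this
  have hgc := growthConst_pos hk0 hκ
  have hk0' : (0 : ℝ) < k := by exact_mod_cast hk0
  have hscale : ∀ X : ℝ, X ^ e * (growthConst k κ * δ * D ^ e) =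
      growthConst k κ * (X * D / L) ^ e * (δ * L ^ e) := fun X => by
    rw [div_pow, mul_pow]; field_simp
  -- The Vandermonde determinant of the cluster is a denominator for p(n), so this product is an
  -- integer. `isolationConst` is chosen so that (2kh/|T|) D/L = 1/(`growthConst` + 1).
  have hsmall : |vand (fun i => (x i : ℝ)) * ((m n : ℝ) - p.eval (n : ℝ))| < 1 := by
    rw [abs_mul]
    calc |vand (fun i => (x i : ℝ))| * |(m n : ℝ) - p.eval (n : ℝ)|
        ≤ (2 * k * h / T.card) ^ e * (growthConst k κ * δ * D ^ e) := by gcongr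
      _ = growthConst k κ * ((2 * k * h / T.card) * D / L) ^ e * (δ * L ^ e) := hscale _
      _ = growthConst k κ * ((growthConst k κ + 1)⁻¹) ^ e * (δ * L ^ e) := by
          congr 3
          rw [hD, isolationConst]
          field_simp
      _ ≤ growthConst k κ * ((growthConst k κ + 1)⁻¹) ^ e * 1 := by gcongr
      _ ≤ growthConst k κ * ((growthConst k κ + 1)⁻¹) := by
          rw [mul_one]
          gcongr
          refine pow_le_of_le_one (by positivity) ?_ (by omega)
          exact inv_le_one_of_one_le₀ (by linarith)
      _ < 1 := by
          rw [← div_eq_mul_inv, div_lt_one (by linarith)]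
          linarith
  rw [mul_sub, hz, vand_intCast] at hsmall
  have h1 : |vand x * m n - z| < 1 := by exact_mod_cast hsmall
  have h2 : vand x * m n - z = 0 := Int.abs_lt_one_iff.1 h1
  have h3 : vand (fun i => (x i : ℝ)) * p.eval (n : ℝ) = vand (fun i => (x i : ℝ)) * m n := by
    rw [hz, vand_intCast]
    exact_mod_cast (sub_eq_zero.1 h2).symm
  exact mul_left_cancel₀ hV0 h3

/-- Data of all the dense blocks which belong to the same polynomial and the same class. -/
theorem exists_arc {A B : ℝ} {F : ℕ → ℝ → ℝ} (hF : IsDerivTower (Icc A B) F)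
    {k : ℕ} (hk : 3 ≤ k) {lam κ δ L E : ℝ} (hκ : 0 ≤ κ) (hlam0 : 0 < lam)
    (hlam : ∀ x ∈ Icc A B, lam ≤ |F k x| ∧ |F k x| ≤ κ * lam)
    (hδ : 0 < δ) (hL : 0 < L) (hδL : δ * L ^ k.choose 2 ≤ 1)
    (hE : 0 ≤ E) (hEδ : δ ≤ lam * E ^ k) {p : Polynomial ℝ}
    (hp : p.degree < k) (m : ℤ → ℤ) (S : Finset ℤ) (hS : ∀ n ∈ S, (n : ℝ) ∈ Icc A B)
    (hSm : ∀ n ∈ S, |F 0 n - m n| < δ) (cls : ℝ → Fin k)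
    (hcls : ∀ s ∈ Icc A B, ∀ t ∈ Icc A B, s ≤ t → cls s = cls t →
      |F 0 s - p.eval s| < δ → |F 0 t - p.eval t| < δ → ∀ x ∈ Icc s t, |F 0 x - p.eval x| < δ)
    (c : Fin k) (R : Finset ℕ) (hR : R.Nonempty) (T : ℕ → Finset ℤ)
    (hTS : ∀ j ∈ R, ∀ n ∈ T j, n ∈ S) (hTblk : ∀ j ∈ R, ∀ n ∈ T j, ⌊((n : ℝ) - A) / L⌋₊ = j)
    (hTp : ∀ j ∈ R, ∀ n ∈ T j, p.eval (n : ℝ) = m n) (hTc : ∀ j ∈ R, ∀ n ∈ T j, cls n = c)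
    (hTcard : ∀ j ∈ R, k * k ≤ (T j).card)
    (hTcard' : ∀ j ∈ R, 1 ≤ isolationConst k κ * (T j).card) :
    ∃ a b r : ℝ, A ≤ a ∧ a ≤ b ∧ b ≤ B ∧ (∀ j ∈ R, ∀ n ∈ T j, (n : ℝ) ∈ Icc a b) ∧ b - a ≤ r ∧
      (∑ j ∈ R, (T j).card : ℝ) ≤ 3 / (isolationConst k κ * L) * r ∧
      (∑ j ∈ R, (T j).card : ℝ) ≤ lengthConst k * E + 1 ∧
      ∀ n ∈ S, (n : ℝ) ∈ Icc (a - r) (b + r) → p.eval (n : ℝ) = m n := by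
  have hk0 : 0 < k := by omega
  have hic := isolationConst_pos hk0 hκ
  -- The fullest block bounds the total count and also fixes the radius of isolation.
  obtain ⟨j₀, hj₀, hmax⟩ := R.exists_max_image (fun j => (T j).card) hR
  have h9 : 2 ≤ (T j₀).card := le_trans (by nlinarith) (hTcard j₀ hj₀)
  have hTne : (T j₀).Nonempty := Finset.card_pos.1 (by omega)
  set U := R.biUnion T with hU
  have hUmem : ∀ j ∈ R, ∀ n ∈ T j, n ∈ U := fun j hj n hn => Finset.mem_biUnion.2 ⟨j, hj, hn⟩
  have hUne : U.Nonempty := ⟨_, hUmem j₀ hj₀ _ hTne.choose_spec⟩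
  set a := U.min' hUne with ha
  set b := U.max' hUne with hb
  set a' := (T j₀).min' hTne with ha'
  set b' := (T j₀).max' hTne with hb'
  have hUab : ∀ n ∈ U, (n : ℝ) ∈ Icc (a : ℝ) b := fun n hn =>
    ⟨by exact_mod_cast U.min'_le n hn, by exact_mod_cast U.le_max' n hn⟩
  have haU : a ∈ U := U.min'_mem hUne
  have hbU : b ∈ U := U.max'_mem hUne
  have hTab : ∀ n ∈ T j₀, (n : ℝ) ∈ Icc (a' : ℝ) b' := fun n hn =>
    ⟨by exact_mod_cast (T j₀).min'_le n hn, by exact_mod_cast (T j₀).le_max' n hn⟩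
  have ha'T : a' ∈ T j₀ := (T j₀).min'_mem hTne
  have hb'T : b' ∈ T j₀ := (T j₀).max'_mem hTne
  have hab' : (a' : ℝ) < b' := by
    exact_mod_cast Finset.min'_lt_max'_of_card (T j₀) (by omega)
  have hUS : ∀ n ∈ U, n ∈ S := fun n hn => by
    obtain ⟨j, hj, hn⟩ := Finset.mem_biUnion.1 hn
    exact hTS j hj n hn
  have hUp : ∀ n ∈ U, p.eval (n : ℝ) = m n := fun n hn => by
    obtain ⟨j, hj, hn⟩ := Finset.mem_biUnion.1 hn
    exact hTp j hj n hn
  have hUc : ∀ n ∈ U, cls n = c := fun n hn => by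
    obtain ⟨j, hj, hn⟩ := Finset.mem_biUnion.1 hn
    exact hTc j hj n hn
  set h : ℝ := b' - a' with hh
  set ℓ : ℝ := b - a with hℓ
  have hh0 : 0 < h := sub_pos.2 hab'
  have hhℓ : h ≤ ℓ := by
    have h1 := (hUab a' (hUmem _ hj₀ _ ha'T)).1
    have h2 := (hUab b' (hUmem _ hj₀ _ hb'T)).2
    linarith
  have hℓ0 : 0 < ℓ := hh0.trans_le hhℓ
  have hblk : ∀ n ∈ S, (⌊((n : ℝ) - A) / L⌋₊ : ℝ) ≤ ((n : ℝ) - A) / L ∧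
      ((n : ℝ) - A) / L < ⌊((n : ℝ) - A) / L⌋₊ + 1 := fun n hn =>
    ⟨Nat.floor_le (div_nonneg (sub_nonneg.2 (hS n hn).1) hL.le), Nat.lt_floor_add_one _⟩
  have hhL : h ≤ L := by
    have h1 := (hblk a' (hTS _ hj₀ _ ha'T)).1
    have h2 := (hblk b' (hTS _ hj₀ _ hb'T)).2
    rw [hTblk _ hj₀ _ ha'T] at h1
    rw [hTblk _ hj₀ _ hb'T] at h2
    have h3 : ((b' : ℝ) - A) / L - ((a' : ℝ) - A) / L ≤ 1 := by linarith
    rw [← sub_div, div_le_one hL] at h3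
    linarith
  -- The 2 accounts for the partial blocks at the two ends of the arc.
  have hRcard : (R.card : ℝ) ≤ ℓ / L + 2 := by
    have h1 : R ⊆ Finset.Icc ⌊((a : ℝ) - A) / L⌋₊ ⌊((b : ℝ) - A) / L⌋₊ := by
      intro j hj
      have hne : (T j).Nonempty := Finset.card_pos.1 (lt_of_lt_of_le (by positivity) (hTcard j hj))
      obtain ⟨n, hn⟩ := hne
      have hnU := hUab n (hUmem j hj n hn)
      rw [Finset.mem_Icc, ← hTblk j hj n hn]
      constructor
      · refine Nat.floor_le_floor ?_
        gcongr; exact_mod_cast hnU.1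
      · refine Nat.floor_le_floor ?_
        gcongr; exact_mod_cast hnU.2
    have h2 := Finset.card_le_card h1
    rw [Nat.card_Icc] at h2
    have h3 : ⌊((a : ℝ) - A) / L⌋₊ ≤ ⌊((b : ℝ) - A) / L⌋₊ + 1 := by
      refine (Nat.floor_le_floor ?_).trans (Nat.le_succ _)
      gcongr
      exact_mod_cast sub_nonneg.1 hℓ0.le
    have h4 : R.card + ⌊((a : ℝ) - A) / L⌋₊ ≤ ⌊((b : ℝ) - A) / L⌋₊ + 1 := by omega
    have h5 : (R.card : ℝ) + ⌊((a : ℝ) - A) / L⌋₊ ≤ ⌊((b : ℝ) - A) / L⌋₊ + 1 := by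
      exact_mod_cast h4
    have h6 := (hblk b (hUS _ hbU)).1
    have h7 := (hblk a (hUS _ haU)).2
    have h8 : ℓ / L = ((b : ℝ) - A) / L - ((a : ℝ) - A) / L := by rw [hℓ]; ring
    linarith
  have hsm : ∀ x ∈ Icc (a : ℝ) b, |F 0 x - p.eval x| < δ := by
    refine hcls a (hS _ (hUS _ haU)) b (hS _ (hUS _ hbU)) (by linarith)
      (by rw [hUc _ haU, hUc _ hbU]) ?_ ?_
    · rw [hUp _ haU]; exact hSm _ (hUS _ haU)
    · rw [hUp _ hbU]; exact hSm _ (hUS _ hbU)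
  have hbaℓ : (a : ℝ) + ℓ = b := by rw [hℓ]; ring
  have hlen : lam * ℓ ^ k ≤ lengthConst k * δ := by
    refine (hF.sub (isDerivTower_polyTower (Icc A B) p)).length_le hk0 (a := a)
      (fun x hx => ?_) hδ.le hℓ0 (hS _ (hUS _ haU)).1 (by rw [hbaℓ]; exact (hS _ (hUS _ hbU)).2)
      (fun x hx => (hsm x (by rwa [hbaℓ] at hx)).le)
    rw [polyTower_eq_zero hp, sub_zero]
    exact (hlam x hx).1
  have hlc := one_le_lengthConst hk0
  set M := (T j₀).card with hM
  set D := isolationConst k κ * M * L / h with hD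
  have hD1 : 1 ≤ D := by
    rw [hD, le_div_iff₀ hh0]
    have := hTcard' j₀ hj₀
    nlinarith
  refine ⟨a, b, D * ℓ, (hS _ (hUS _ haU)).1, by linarith, (hS _ (hUS _ hbU)).2,
    fun j hj n hn => hUab n (hUmem j hj n hn), ?_, ?_, ?_, ?_⟩
  · nlinarith
  · have h1 : (∑ j ∈ R, (T j).card : ℝ) ≤ R.card * M := by
      rw [← nsmul_eq_mul]
      exact Finset.sum_le_card_nsmul _ _ _ fun j hj => by exact_mod_cast hmax j hj
    have h2 : (R.card : ℝ) ≤ 3 * (ℓ / h) := by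
      have h3 : ℓ / L ≤ ℓ / h := by gcongr
      have h4 : 1 ≤ ℓ / h := by rwa [one_le_div hh0]
      linarith
    calc _ ≤ (R.card : ℝ) * M := h1
      _ ≤ 3 * (ℓ / h) * M := by gcongr
      _ = _ := by rw [hD]; field_simp
  · have h1 : (∑ j ∈ R, (T j).card) = U.card := by
      rw [hU, Finset.card_biUnion]
      intro i hi j hj hij
      refine Finset.disjoint_left.2 fun n hn hn' => ?_
      exact hij ((hTblk i hi n hn).symm.trans (hTblk j hj n hn'))
    have h2 : (U.card : ℝ) ≤ ℓ / 1 + 1 := by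
      refine card_le_of_spaced U one_pos hℓ0.le ?_ ?_
      · intro n _ n' _ hlt
        have : n + 1 ≤ n' := hlt
        have : (n : ℝ) + 1 ≤ n' := by exact_mod_cast this
        linarith
      · intro n hn n' hn' _
        linarith [(hUab n hn).1, (hUab n' hn').2]
    have h3 : ℓ ≤ lengthConst k * E := by
      refine le_of_pow_le_pow_left₀ hk0.ne' (by positivity) ?_
      refine le_of_mul_le_mul_left ?_ hlam0
      calc lam * ℓ ^ k ≤ lengthConst k * δ := hlen
        _ ≤ lengthConst k * (lam * E ^ k) := by gcongr
        _ ≤ lengthConst k ^ k * (lam * E ^ k) := by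
            gcongr; exact le_self_pow₀ hlc hk0.ne'
        _ = _ := by ring
    rw [← Nat.cast_sum, h1]
    linarith
  · intro n hn hnr
    refine eval_eq_of_near_arc hF hk hκ hlam hδ.le hL hδL hp m (a := a) hℓ0 (hS _ (hUS _ haU)).1
      (by rw [hbaℓ]; exact (hS _ (hUS _ hbU)).2) (fun x hx => (hsm x (by rwa [hbaℓ] at hx)).le)
      (T j₀) (a' := a') hh0 (fun n hn => ?_) (hTp j₀ hj₀) (hTcard j₀ hj₀) hD hD1 (hS n hn)
      (hSm n hn).le (by rwa [hbaℓ])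
    have : (a' : ℝ) + h = b' := by rw [hh]; ring
    rw [this]
    exact hTab n hn

/-- The number of points in dense blocks of one class. -/
theorem sum_dense_blocks_le {A B : ℝ} {F : ℕ → ℝ → ℝ} (hF : IsDerivTower (Icc A B) F)
    (hAB : A ≤ B) {k : ℕ} (hk : 3 ≤ k) {lam κ δ L E : ℝ} (hκ : 0 ≤ κ) (hlam0 : 0 < lam)
    (hlam : ∀ x ∈ Icc A B, lam ≤ |F k x| ∧ |F k x| ≤ κ * lam)
    (hδ : 0 < δ) (hL : 0 < L) (hδL : δ * L ^ k.choose 2 ≤ 1)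
    (hE : 0 ≤ E) (hEδ : δ ≤ lam * E ^ k) (m : ℤ → ℤ) (S : Finset ℤ)
    (hS : ∀ n ∈ S, (n : ℝ) ∈ Icc A B)
    (hSm : ∀ n ∈ S, |F 0 n - m n| < δ) (cls : Polynomial ℝ → ℝ → Fin k)
    (hcls : ∀ p : Polynomial ℝ, p.degree < k →
      ∀ s ∈ Icc A B, ∀ t ∈ Icc A B, s ≤ t → cls p s = cls p t →
      |F 0 s - p.eval s| < δ → |F 0 t - p.eval t| < δ → ∀ x ∈ Icc s t, |F 0 x - p.eval x| < δ)
    (c : Fin k) (R : Finset ℕ) (T : ℕ → Finset ℤ) (P : ℕ → Polynomial ℝ)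
    (hP : ∀ j, (P j).degree < k)
    (hTS : ∀ j ∈ R, ∀ n ∈ T j, n ∈ S) (hTblk : ∀ j ∈ R, ∀ n ∈ T j, ⌊((n : ℝ) - A) / L⌋₊ = j)
    (hTp : ∀ j ∈ R, ∀ n ∈ T j, (P j).eval (n : ℝ) = m n)
    (hTc : ∀ j ∈ R, ∀ n ∈ T j, cls (P j) n = c)
    (hTcard : ∀ j ∈ R, k * k ≤ (T j).card)
    (hTcard' : ∀ j ∈ R, 1 ≤ isolationConst k κ * (T j).card) :
    (∑ j ∈ R, (T j).card : ℝ) ≤ 3 / (isolationConst k κ * L) * (2 * (B - A)) +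
      (lengthConst k * E + 1) := by
  classical
  have hk0 : 0 < k := by omega
  have hic := isolationConst_pos hk0 hκ
  have hlc := one_le_lengthConst hk0
  rcases R.eq_empty_or_nonempty with rfl | hR
  · have : 0 ≤ B - A := by linarith
    simp only [Finset.sum_empty]
    positivity
  set Q := R.image P with hQ
  have hfil : ∀ p : Polynomial ℝ, ∀ j, j ∈ R.filter (fun j => P j = p) → j ∈ R ∧ P j = p :=
    fun p j hj => Finset.mem_filter.1 hj
  have key : ∀ p ∈ Q, ∃ a b r : ℝ, A ≤ a ∧ a ≤ b ∧ b ≤ B ∧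
      (∀ j ∈ R.filter (fun j => P j = p), ∀ n ∈ T j, (n : ℝ) ∈ Icc a b) ∧ b - a ≤ r ∧
      (∑ j ∈ R.filter (fun j => P j = p), (T j).card : ℝ) ≤ 3 / (isolationConst k κ * L) * r ∧
      (∑ j ∈ R.filter (fun j => P j = p), (T j).card : ℝ) ≤ lengthConst k * E + 1 ∧
      ∀ n ∈ S, (n : ℝ) ∈ Icc (a - r) (b + r) → p.eval (n : ℝ) = m n := by
    intro p hp
    obtain ⟨j₀, hj₀, hj₀p⟩ := Finset.mem_image.1 hp
    have hpd : p.degree < k := hj₀p ▸ hP j₀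
    refine exists_arc hF hk hκ hlam0 hlam hδ hL hδL hE hEδ hpd m S hS hSm (cls p) (hcls p hpd) c _
      ⟨j₀, Finset.mem_filter.2 ⟨hj₀, hj₀p⟩⟩ T (fun j hj => hTS j (hfil p j hj).1)
      (fun j hj => hTblk j (hfil p j hj).1) (fun j hj n hn => ?_) (fun j hj n hn => ?_)
      (fun j hj => hTcard j (hfil p j hj).1) (fun j hj => hTcard' j (hfil p j hj).1)
    · have := hTp j (hfil p j hj).1 n hn
      rwa [(hfil p j hj).2] at this
    · have := hTc j (hfil p j hj).1 n hn
      rwa [(hfil p j hj).2] at this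
  choose! a b r h1 h2 h3 h4 h5 h6 h7 h8 using key
  -- If the arc of q lay in the enlargement of that of p, a dense block of q would lie on p, giving
  -- k common values and p = q.
  obtain ⟨p₀, hp₀, hsum⟩ := sum_radius_le Q (hR.image P) a b r h1 h2
    (fun p hp => (h2 p hp).trans (h3 p hp)) h5 (by
      intro p hp q hq hpq ⟨hl, hr⟩
      obtain ⟨j, hj, rfl⟩ := Finset.mem_image.1 hq
      have hjf : j ∈ R.filter (fun i => P i = P j) := Finset.mem_filter.2 ⟨hj, rfl⟩
      apply hpq
      refine Polynomial.eq_of_degrees_lt_of_eval_finset_eq ((T j).image (fun n : ℤ => (n : ℝ)))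
        ?_ ?_ ?_
      · obtain ⟨i, _, rfl⟩ := Finset.mem_image.1 hp
        refine (hP i).trans_le ?_
        rw [Finset.card_image_of_injective _ Int.cast_injective]
        have := hTcard j hj
        exact_mod_cast (by nlinarith : k ≤ (T j).card)
      · refine (hP j).trans_le ?_
        rw [Finset.card_image_of_injective _ Int.cast_injective]
        have := hTcard j hj
        exact_mod_cast (by nlinarith : k ≤ (T j).card)
      · intro x hx
        obtain ⟨n, hn, rfl⟩ := Finset.mem_image.1 hx
        have hnab := h4 _ hq j hjf n hn
        rw [hTp j hj n hn]
        exact h8 p hp n (hTS j hj n hn) ⟨hl.trans hnab.1, hnab.2.trans hr⟩)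
  have hfib : (∑ j ∈ R, (T j).card : ℝ) =
      ∑ p ∈ Q, ∑ j ∈ R.filter (fun j => P j = p), ((T j).card : ℝ) :=
    (Finset.sum_fiberwise_of_maps_to (fun j hj => Finset.mem_image_of_mem P hj) _).symm
  rw [hfib, ← Finset.sum_erase_add _ _ hp₀]
  refine add_le_add ?_ (h7 p₀ hp₀)
  calc _ ≤ ∑ p ∈ Q.erase p₀, 3 / (isolationConst k κ * L) * r p :=
        Finset.sum_le_sum fun p hp => h6 p (Finset.mem_of_mem_erase hp)
    _ = 3 / (isolationConst k κ * L) * ∑ p ∈ Q.erase p₀, r p := by rw [Finset.mul_sum]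
    _ ≤ _ := by gcongr

/-- Integer points close to a curve with `k`-th derivative of size `lam`. -/
theorem card_close_le {A B : ℝ} {F : ℕ → ℝ → ℝ} (hF : IsDerivTower (Icc A B) F)
    (hAB : A ≤ B) {k : ℕ} (hk : 3 ≤ k) {lam κ δ L E : ℝ} (hκ : 0 ≤ κ) (hlam0 : 0 < lam)
    (hlam : ∀ x ∈ Icc A B, lam ≤ |F k x| ∧ |F k x| ≤ κ * lam)
    (hδ : 0 < δ) (hL : 0 < L) (hδL : δ * L ^ k.choose 2 ≤ 1)
    (hsmall : κ * lam / k.factorial * L ^ (k + 1).choose 2 + (k + 1) * δ * L ^ k.choose 2 < 1)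
    (hE : 0 ≤ E) (hEδ : δ ≤ lam * E ^ k) (m : ℤ → ℤ) (S : Finset ℤ)
    (hS : ∀ n ∈ S, (n : ℝ) ∈ Icc A B) (hSm : ∀ n ∈ S, |F 0 n - m n| < δ)
    (K : ℕ) (hK : k * k ≤ K) (hK' : 1 ≤ isolationConst k κ * K) :
    (S.card : ℝ) ≤ k * (K * ((B - A) / L + 1) + (3 / (isolationConst k κ * L) * (2 * (B - A)) +
      (lengthConst k * E + 1))) := by
  classical
  have hk0 : 0 < k := by omega
  have hic := isolationConst_pos hk0 hκ
  set blk : ℤ → ℕ := fun n => ⌊((n : ℝ) - A) / L⌋₊ with hblk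
  have hblk' : ∀ n ∈ S, (blk n : ℝ) ≤ ((n : ℝ) - A) / L ∧
      ((n : ℝ) - A) / L < blk n + 1 := fun n hn =>
    ⟨Nat.floor_le (div_nonneg (sub_nonneg.2 (hS n hn).1) hL.le), Nat.lt_floor_add_one _⟩
  have hPex : ∀ j : ℕ, ∃ p : Polynomial ℝ, p.degree < k ∧
      ∀ n ∈ S.filter (fun n => blk n = j), p.eval (n : ℝ) = m n := by
    intro j
    refine exists_polynomial_of_close hF (fun x hx => (hlam x hx).2) hδ.le m _
      (fun n hn => hS n (Finset.mem_filter.1 hn).1)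
      (fun n hn => (hSm n (Finset.mem_filter.1 hn).1).le) ?_ hsmall
    intro n hn n' hn'
    obtain ⟨hn, hj⟩ := Finset.mem_filter.1 hn
    obtain ⟨hn', hj'⟩ := Finset.mem_filter.1 hn'
    have e1 := hblk' n hn
    have e2 := hblk' n' hn'
    rw [hj] at e1
    rw [hj'] at e2
    have h3 : |((n : ℝ) - A) / L - ((n' : ℝ) - A) / L| ≤ 1 := by
      rw [abs_le]; constructor <;> linarith
    rw [← sub_div, abs_div, abs_of_pos hL, div_le_one hL] at h3
    simpa using h3
  choose P hPdeg hPm using hPex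
  have hclsex : ∀ p : Polynomial ℝ, ∃ cls : ℝ → Fin k, p.degree < k →
      ∀ s ∈ Icc A B, ∀ t ∈ Icc A B, s ≤ t → cls s = cls t →
      |F 0 s - p.eval s| < δ → |F 0 t - p.eval t| < δ →
        ∀ x ∈ Icc s t, |F 0 x - p.eval x| < δ := by
    intro p
    by_cases hp : p.degree < k
    · obtain ⟨cls, h⟩ := (hF.sub (isDerivTower_polyTower (Icc A B) p)).exists_class hk0
        (fun x hx h0 => by
          rw [polyTower_eq_zero hp, sub_zero] at h0
          have := (hlam x hx).1
          rw [h0, abs_zero] at this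
          linarith)
      exact ⟨cls, fun _ => h δ⟩
    -- An arbitrary class map for polynomials of degree at least k, which never occur among the `P
    -- j`.
    · exact ⟨fun _ => ⟨0, hk0⟩, fun h => absurd h hp⟩
  choose cls hcls using hclsex
  set T : Fin k → ℕ → Finset ℤ := fun c j =>
    (S.filter (fun n => blk n = j)).filter (fun n => cls (P j) n = c) with hT
  have hTmem : ∀ c j n, n ∈ T c j → n ∈ S ∧ blk n = j ∧ cls (P j) n = c := by
    intro c j n hn
    obtain ⟨h1, h2⟩ := Finset.mem_filter.1 hn
    obtain ⟨h1, h3⟩ := Finset.mem_filter.1 h1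
    exact ⟨h1, h3, h2⟩
  set J := Finset.range (⌊(B - A) / L⌋₊ + 1) with hJ
  have hJS : ∀ n ∈ S, blk n ∈ J := by
    intro n hn
    rw [hJ, Finset.mem_range, Nat.lt_succ_iff]
    refine Nat.floor_le_floor ?_
    gcongr
    exact (hS n hn).2
  have hJcard : (J.card : ℝ) ≤ (B - A) / L + 1 := by
    rw [hJ, Finset.card_range]
    push_cast
    gcongr
    exact Nat.floor_le (div_nonneg (by linarith) hL.le)
  have hScard : (S.card : ℝ) = ∑ c : Fin k, ∑ j ∈ J, ((T c j).card : ℝ) := by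
    have h1 : S.card = ∑ j ∈ J, ∑ c : Fin k, (T c j).card := by
      rw [Finset.card_eq_sum_card_fiberwise (f := blk) (t := J) hJS]
      refine Finset.sum_congr rfl fun j _ => ?_
      exact Finset.card_eq_sum_card_fiberwise (fun _ _ => Finset.mem_coe.2 (Finset.mem_univ _))
    rw [h1, Finset.sum_comm]
    push_cast
    rfl
  have hclass : ∀ c : Fin k, ∑ j ∈ J, ((T c j).card : ℝ) ≤ K * ((B - A) / L + 1) +
      (3 / (isolationConst k κ * L) * (2 * (B - A)) + (lengthConst k * E + 1)) := by
    intro c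
    -- Sparse blocks cost at most K points each; dense blocks fall under the arc estimate.
    rw [← Finset.sum_filter_not_add_sum_filter J (fun j => K ≤ (T c j).card)]
    refine add_le_add ?_ ?_
    · calc _ ≤ ∑ j ∈ J.filter (fun j => ¬ K ≤ (T c j).card), (K : ℝ) := by
            refine Finset.sum_le_sum fun j hj => ?_
            have := (Finset.mem_filter.1 hj).2
            exact_mod_cast (not_le.1 this).le
        _ = (J.filter (fun j => ¬ K ≤ (T c j).card)).card * (K : ℝ) := by simp
        _ ≤ J.card * (K : ℝ) := by
            gcongr
            exact Finset.filter_subset _ _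
        _ ≤ ((B - A) / L + 1) * K := by gcongr
        _ = _ := mul_comm _ _
    · have hf : ∀ j ∈ J.filter (fun j => K ≤ (T c j).card), K ≤ (T c j).card :=
        fun j hj => (Finset.mem_filter.1 hj).2
      refine sum_dense_blocks_le hF hAB hk hκ hlam0 hlam hδ hL hδL hE hEδ m S hS hSm cls hcls c _
        (T c) P hPdeg (fun j _ n hn => (hTmem c j n hn).1) (fun j _ n hn => (hTmem c j n hn).2.1)
        (fun j _ n hn => hPm j n (Finset.mem_filter.1 hn).1)
        (fun j _ n hn => (hTmem c j n hn).2.2) (fun j hj => hK.trans (hf j hj)) (fun j hj => ?_)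
      refine hK'.trans ?_
      have : (K : ℝ) ≤ (T c j).card := by exact_mod_cast hf j hj
      gcongr
  rw [hScard]
  refine (Finset.sum_le_sum fun c _ => hclass c).trans ?_
  rw [Finset.sum_const, Finset.card_univ, Fintype.card_fin, nsmul_eq_mul]

/-! ### First-derivative bound and counting by gaps -/

theorem DerivsComparable.exists_tower {c : ℕ → ℝ} {N : ℕ} (hN : 1 ≤ N) {T : ℝ} {f : ℝ → ℝ}
    (h : DerivsComparable c N T f) :
    ∃ F : ℕ → ℝ → ℝ, F 0 = f ∧ IsDerivTower (Icc (N : ℝ) (2 * N)) F ∧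
      ∀ j, ∀ x ∈ Icc (N : ℝ) (2 * N), (c j)⁻¹ * (T / (N : ℝ) ^ j) ≤ |F j x| ∧
        |F j x| ≤ c j * (T / (N : ℝ) ^ j) := by
  have hN' : (1 : ℝ) ≤ N := by exact_mod_cast hN
  have hu : UniqueDiffOn ℝ (Icc (N : ℝ) (2 * N)) := uniqueDiffOn_Icc (by linarith)
  refine ⟨fun j => iteratedDerivWithin j f (Icc (N : ℝ) (2 * N)), iteratedDerivWithin_zero,
    fun j x hx => ?_, h.2⟩
  have hd := (h.1.differentiableOn_iteratedDerivWithin (m := j)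
    (by exact_mod_cast WithTop.coe_lt_top (j : ℕ)) hu) x hx
  have := hd.hasDerivWithinAt
  rwa [← iteratedDerivWithin_succ] at this

/-- The close points as a finite set, with the nearest integers to the values. -/
theorem exists_finset_closePoints (f : ℝ → ℝ) (N : ℕ) (δ : ℝ) :
    ∃ S : Finset ℤ, closeCount f N δ = S.card ∧ (∀ n ∈ S, (n : ℝ) ∈ Icc (N : ℝ) (2 * N)) ∧
      ∀ n ∈ S, |f n - (round (f n) : ℤ)| < δ := by
  refine ⟨(closePoints_finite f N δ).toFinset, Set.ncard_eq_toFinset_card _ _, ?_, ?_⟩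
  · intro n hn
    have h := (Set.Finite.mem_toFinset _).1 hn
    exact ⟨by exact_mod_cast h.1, by exact_mod_cast h.2.1⟩
  · intro n hn
    exact ((Set.Finite.mem_toFinset _).1 hn).2.2

theorem one_le_sub_of_lt {n n' : ℤ} (h : n < n') : (1 : ℝ) ≤ (n' : ℝ) - n := by
  have : (n : ℝ) + 1 ≤ n' := by exact_mod_cast h
  linarith

theorem card_le_mul_of_fiber_le (S : Finset ℤ) (g : ℤ → ℤ) {a b : ℝ} (hb : 0 ≤ b)
    (ha : ((S.image g).card : ℝ) ≤ a)
    (hfib : ∀ y, ((S.filter (fun n => g n = y)).card : ℝ) ≤ b) : (S.card : ℝ) ≤ a * b := by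
  calc (S.card : ℝ) = ∑ y ∈ S.image g, ((S.filter (fun n => g n = y)).card : ℝ) := by
        exact_mod_cast Finset.card_eq_sum_card_fiberwise
          (fun n hn => Finset.mem_coe.2 (Finset.mem_image_of_mem g hn))
    _ ≤ ∑ y ∈ S.image g, b := Finset.sum_le_sum fun y _ => hfib y
    _ = (S.image g).card * b := by simp
    _ ≤ a * b := by gcongr

theorem IsDerivTower.exists_slope {A B : ℝ} {F : ℕ → ℝ → ℝ} (hF : IsDerivTower (Icc A B) F)
    (j : ℕ) {x y : ℝ} (hx : A ≤ x) (hxy : x < y) (hy : y ≤ B) :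
    ∃ ξ ∈ Icc A B, F j y - F j x = F (j + 1) ξ * (y - x) := by
  have hsub : Icc x y ⊆ Icc A B := Icc_subset_Icc hx hy
  obtain ⟨ξ, hξ, h⟩ := exists_hasDerivAt_eq_slope (F j) (F (j + 1)) hxy
    ((hF.mono hsub).continuousOn j) (fun z hz => (hF.mono hsub).hasDerivAt j hz)
  refine ⟨ξ, hsub (Ioo_subset_Icc_self hξ), ?_⟩
  rw [h, div_mul_cancel₀ _ (sub_pos.2 hxy).ne']

/-- The bound by `T`, from the first derivative alone. -/
theorem closeCount_le_mul {c : ℕ → ℝ} (hc : ∀ j, 1 ≤ c j) {N : ℕ} {δ T : ℝ} {f : ℝ → ℝ}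
    (hN : 1 ≤ N) (hδ : 0 < δ) (hT : 1 ≤ T) (hf : DerivsComparable c N T f)
    (hNδ : (N : ℝ) * δ ≤ T) (hTδ : T ≤ δ⁻¹) :
    (closeCount f N δ : ℝ) ≤ (2 * c 0 + 3) * (2 * c 1 + 1) * T := by
  obtain ⟨F, rfl, hF, hb⟩ := hf.exists_tower hN
  obtain ⟨S, hcount, hS, hSm⟩ := exists_finset_closePoints (F 0) N δ
  have hN' : (1 : ℝ) ≤ N := by exact_mod_cast hN
  have hδ1 : δ ≤ 1 := by
    have := hT.trans hTδ
    rwa [one_le_inv₀ hδ] at this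
  have hc0 := hc 0
  have hc1 := hc 1
  rw [hcount, mul_right_comm]
  refine card_le_mul_of_fiber_le S (fun n => round (F 0 n)) (by linarith) ?_ fun y => ?_
  · have hr : ∀ n ∈ S, |((round (F 0 n) : ℤ) : ℝ)| ≤ c 0 * T + 1 := by
      intro n hn
      have h1 := (hb 0 n (hS n hn)).2
      rw [pow_zero, div_one] at h1
      have h2 := hSm n hn
      have h3 := abs_sub_abs_le_abs_sub ((round (F 0 n) : ℤ) : ℝ) (F 0 n)
      rw [abs_sub_comm] at h3
      linarith
    have := card_le_of_spaced (S.image fun n : ℤ => round (F 0 (n : ℝ))) (d := 1)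
      (D := 2 * (c 0 * T + 1)) one_pos (by nlinarith)
      (fun n _ n' _ h => one_le_sub_of_lt h) (by
        intro n hn n' hn' _
        obtain ⟨u, hu, rfl⟩ := Finset.mem_image.1 hn
        obtain ⟨u', hu', rfl⟩ := Finset.mem_image.1 hn'
        have h1 := abs_le.1 (hr u hu)
        have h2 := abs_le.1 (hr u' hu')
        linarith [h1.1, h2.2])
    nlinarith
  · have := card_le_of_spaced (S.filter fun n : ℤ => round (F 0 (n : ℝ)) = y) (d := 1)
      (D := 2 * c 1) one_pos (by linarith)
      (fun n _ n' _ h => one_le_sub_of_lt h) (by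
        intro n hn n' hn' hlt
        obtain ⟨hn, hy⟩ := Finset.mem_filter.1 hn
        obtain ⟨hn', hy'⟩ := Finset.mem_filter.1 hn'
        have hlt' : (n : ℝ) < n' := by exact_mod_cast hlt
        obtain ⟨ξ, hξ, h1⟩ := hF.exists_slope 0 (hS n hn).1 hlt' (hS n' hn').2
        have h2 : |F 0 n' - F 0 n| ≤ 2 * δ := by
          have e1 := hSm n hn
          have e2 := hSm n' hn'
          rw [hy] at e1
          rw [hy'] at e2
          rw [abs_lt] at e1 e2
          rw [abs_le]
          constructor <;> linarith [e1.1, e1.2, e2.1, e2.2]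
        have h3 := (hb 1 ξ hξ).1
        rw [h1, abs_mul, abs_of_pos (sub_pos.2 hlt')] at h2
        have h4 : (c 1)⁻¹ * (T / N ^ 1) * ((n' : ℝ) - n) ≤ 2 * δ :=
          le_trans (mul_le_mul_of_nonneg_right h3 (sub_pos.2 hlt').le) h2
        have h5 : T * ((n' : ℝ) - n) ≤ T * (2 * c 1) := by
          rw [pow_one] at h4
          have e : (c 1)⁻¹ * (T / N) * ((n' : ℝ) - n) = T * ((n' : ℝ) - n) / (c 1 * N) := by
            field_simp
          rw [e, div_le_iff₀ (by positivity)] at h4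
          calc _ ≤ 2 * δ * (c 1 * N) := h4
            _ = 2 * c 1 * (N * δ) := by ring
            _ ≤ 2 * c 1 * T := by gcongr
            _ = _ := mul_comm _ _
        exact le_of_mul_le_mul_left h5 (by linarith))
    linarith

/-- Splitting a finite set of integers according to the distance to the next element. -/
theorem card_le_by_gaps (S : Finset ℤ) {Y D : ℝ} (hY : 0 < Y) (hD : 0 ≤ D)
    (hdiam : ∀ n ∈ S, ∀ n' ∈ S, (n' : ℝ) - n ≤ D) :
    (S.card : ℝ) ≤ (D / Y + 2) + ∑ d ∈ Finset.Icc 1 ⌊Y⌋₊,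
      ((S.filter fun n => n + (d : ℤ) ∈ S ∧ ∀ n' ∈ S, n < n' → n + (d : ℤ) ≤ n').card : ℝ) := by
  classical
  rcases S.eq_empty_or_nonempty with rfl | hne
  · simp only [Finset.card_empty, Nat.cast_zero]
    positivity
  set Q : ℕ → Finset ℤ := fun d =>
    S.filter fun n => n + (d : ℤ) ∈ S ∧ ∀ n' ∈ S, n < n' → n + (d : ℤ) ≤ n' with hQ
  -- The points followed by a gap of at least Y; the largest element of S qualifies vacuously.
  set G := S.filter fun n => ∀ n' ∈ S, n < n' → Y ≤ (n' : ℝ) - n with hG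
  have hcov : S ⊆ G ∪ (Finset.Icc 1 ⌊Y⌋₊).biUnion Q := by
    intro n hn
    rw [Finset.mem_union]
    by_cases hnG : n ∈ G
    · exact Or.inl hnG
    right
    have hex : ∃ n' ∈ S, n < n' ∧ (n' : ℝ) - n < Y := by
      by_contra hno
      push Not at hno
      exact hnG (Finset.mem_filter.2 ⟨hn, hno⟩)
    obtain ⟨n₁, hn₁, hlt, hY₁⟩ := hex
    have hne' : (S.filter (n < ·)).Nonempty := ⟨n₁, Finset.mem_filter.2 ⟨hn₁, hlt⟩⟩
    set s := (S.filter (n < ·)).min' hne' with hs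
    obtain ⟨hsS, hns⟩ := Finset.mem_filter.1 ((S.filter (n < ·)).min'_mem hne')
    have hsn₁ : s ≤ n₁ := Finset.min'_le _ _ (Finset.mem_filter.2 ⟨hn₁, hlt⟩)
    have hcast : (((s - n).toNat : ℕ) : ℤ) = s - n := Int.toNat_of_nonneg (by omega)
    refine Finset.mem_biUnion.2 ⟨(s - n).toNat, Finset.mem_Icc.2 ⟨by omega, ?_⟩, ?_⟩
    · apply Nat.le_floor
      have h1 : (((s - n).toNat : ℕ) : ℝ) = (s : ℝ) - n := by exact_mod_cast hcast
      have h2 : (s : ℝ) ≤ n₁ := by exact_mod_cast hsn₁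
      rw [h1]
      linarith
    · refine Finset.mem_filter.2 ⟨hn, ?_, ?_⟩
      · rw [hcast]
        have : n + (s - n) = s := by ring
        rw [this]
        exact hsS
      · intro n' hn' hlt'
        rw [hcast]
        have : s ≤ n' := Finset.min'_le _ _ (Finset.mem_filter.2 ⟨hn', hlt'⟩)
        omega
  have hGcard : (G.card : ℝ) ≤ D / Y + 1 :=
    card_le_of_spaced G hY hD
      (fun n hn n' hn' hlt => (Finset.mem_filter.1 hn).2 n' (Finset.mem_filter.1 hn').1 hlt)
      (fun n hn n' hn' _ => hdiam n (Finset.mem_filter.1 hn).1 n' (Finset.mem_filter.1 hn').1)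
  have h1 : S.card ≤ G.card + ∑ d ∈ Finset.Icc 1 ⌊Y⌋₊, (Q d).card :=
    (Finset.card_le_card hcov).trans ((Finset.card_union_le _ _).trans
      (Nat.add_le_add_left Finset.card_biUnion_le _))
  have h2 : (S.card : ℝ) ≤ G.card + ∑ d ∈ Finset.Icc 1 ⌊Y⌋₊, ((Q d).card : ℝ) := by
    exact_mod_cast h1
  linarith

/-- The number of close points with the next one at distance `d`. -/
theorem card_gap_le {c : ℕ → ℝ} (hc : ∀ j, 1 ≤ c j) {N : ℕ} {δ T : ℝ} {F : ℕ → ℝ → ℝ}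
    (hN : 1 ≤ N) (hT : 1 ≤ T) (hF : IsDerivTower (Icc (N : ℝ) (2 * N)) F)
    (hb : ∀ j, ∀ x ∈ Icc (N : ℝ) (2 * N), (c j)⁻¹ * (T / (N : ℝ) ^ j) ≤ |F j x| ∧
        |F j x| ≤ c j * (T / (N : ℝ) ^ j))
    (hNδ : (N : ℝ) * δ ≤ T) (hTδ : T * δ ≤ 1) (hbig : 2 * c 1 * N < T ^ 2)
    (S : Finset ℤ) (m : ℤ → ℤ) (hS : ∀ n ∈ S, (n : ℝ) ∈ Icc (N : ℝ) (2 * N))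
    (hSm : ∀ n ∈ S, |F 0 n - m n| < δ) {d : ℕ} (hd : 1 ≤ d) :
    ((S.filter fun n => n + (d : ℤ) ∈ S ∧ ∀ n' ∈ S, n < n' → n + (d : ℤ) ≤ n').card : ℝ) ≤
      12 * (c 1 + 2) ^ 2 * c 2 + 3 * ((c 1 + 2) * T * d / N) := by
  have hN' : (1 : ℝ) ≤ N := by exact_mod_cast hN
  have hd' : (1 : ℝ) ≤ d := by exact_mod_cast hd
  have hc1 := hc 1
  have hc2 := hc 2
  set Q := S.filter fun n => n + (d : ℤ) ∈ S ∧ ∀ n' ∈ S, n < n' → n + (d : ℤ) ≤ n' with hQ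
  set V : ℝ := (c 1 + 2) * T * d / N with hV
  have hQm : ∀ n ∈ Q, n ∈ S ∧ n + (d : ℤ) ∈ S ∧ ∀ n' ∈ S, n < n' → n + (d : ℤ) ≤ n' :=
    fun n hn => Finset.mem_filter.1 hn
  have hdiff : ∀ n ∈ Q, |F 0 ((n : ℝ) + d) - F 0 n - ((m (n + d) - m n : ℤ) : ℝ)| < 2 * δ := by
    intro n hn
    have h1 := hSm n (hQm n hn).1
    have h2 := hSm _ (hQm n hn).2.1
    push_cast at h2 ⊢
    rw [abs_lt] at h1 h2 ⊢
    constructor <;> linarith [h1.1, h1.2, h2.1, h2.2]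
  have hmem : ∀ n ∈ Q, (N : ℝ) ≤ n ∧ (n : ℝ) + d ≤ 2 * N := by
    intro n hn
    have h2 := (hS _ (hQm n hn).2.1).2
    push_cast at h2
    exact ⟨(hS n (hQm n hn).1).1, h2⟩
  -- The increment of m cannot be 0: otherwise T/(c₁N) < 2δ, contradicting T² > 2c₁N since Tδ ≤ 1.
  have he : ∀ n ∈ Q, 1 ≤ |((m (n + d) - m n : ℤ) : ℝ)| ∧ |((m (n + d) - m n : ℤ) : ℝ)| ≤ V := by
    intro n hn
    obtain ⟨ξ, hξ, h1⟩ := hF.exists_slope 0 (hmem n hn).1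
      (show (n : ℝ) < (n : ℝ) + d by linarith) (hmem n hn).2
    have h2 := hdiff n hn
    rw [add_sub_cancel_left] at h1
    have hb1 := hb 1 ξ hξ
    rw [pow_one] at hb1
    constructor
    · rw [← Int.cast_abs]
      have : m (n + d) - m n ≠ 0 := by
        intro h0
        rw [h0, Int.cast_zero, sub_zero, h1, abs_mul, Nat.abs_cast] at h2
        have h3 : (c 1)⁻¹ * (T / N) * 1 ≤ |F 1 ξ| * d := by
          gcongr
          exact hb1.1
        have h4 : (c 1)⁻¹ * (T / N) < 2 * δ := by linarith
        have h5 : (c 1)⁻¹ * (T / N) = T / (c 1 * N) := by field_simp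
        rw [h5, div_lt_iff₀ (by positivity)] at h4
        have h6 : T * T < T * (2 * δ * (c 1 * N)) := by gcongr
        have h7 : T * (2 * δ * (c 1 * N)) = (T * δ) * (2 * c 1 * N) := by ring
        have h8 : (T * δ) * (2 * c 1 * N) ≤ 1 * (2 * c 1 * N) := by gcongr
        nlinarith
      exact_mod_cast Int.one_le_abs this
    · have h3 : |F 0 ((n : ℝ) + d) - F 0 n| ≤ c 1 * (T / N) * d := by
        rw [h1, abs_mul, Nat.abs_cast]
        gcongr
        exact hb1.2
      have h4 : δ ≤ T / N * d := by
        have : δ ≤ T / N := by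
          rw [le_div_iff₀ (by linarith)]
          linarith
        have : T / N * 1 ≤ T / N * d := by gcongr
        linarith
      have h5 : |((m (n + d) - m n : ℤ) : ℝ)| ≤ |F 0 ((n : ℝ) + d) - F 0 n| + 2 * δ := by
        have h6 : ∀ u v : ℝ, |v| ≤ |u| + |u - v| := fun u v => by
          have := abs_sub_abs_le_abs_sub v u
          rw [abs_sub_comm v u] at this
          linarith
        exact (h6 _ _).trans (add_le_add le_rfl h2.le)
      calc _ ≤ c 1 * (T / N) * d + 2 * (T / N * d) := by linarith
        _ = V := by rw [hV]; ring
  have hV0 : 0 ≤ V := by positivity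
  rcases Q.eq_empty_or_nonempty with hQe | ⟨n₀, hn₀⟩
  · rw [hQe, Finset.card_empty, Nat.cast_zero]
    positivity
  have hV1 : 1 ≤ V := (he n₀ hn₀).1.trans (he n₀ hn₀).2
  have hX0 : 0 ≤ 4 * c 2 * N ^ 2 / (T ^ 2 * d) := by positivity
  have hcard : (Q.card : ℝ) ≤ (3 * V) * (4 * c 2 * N ^ 2 / (T ^ 2 * d) / d + 1) := by
    refine card_le_mul_of_fiber_le Q (fun n => m (n + d) - m n) (by positivity) ?_ fun y => ?_
    · have := card_le_of_spaced (Q.image fun n => m (n + d) - m n) (d := 1) (D := 2 * V) one_pos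
        (by linarith) (fun n _ n' _ h => one_le_sub_of_lt h) (by
          intro n hn n' hn' _
          obtain ⟨u, hu, rfl⟩ := Finset.mem_image.1 hn
          obtain ⟨u', hu', rfl⟩ := Finset.mem_image.1 hn'
          have h1 := abs_le.1 (he u hu).2
          have h2 := abs_le.1 (he u' hu').2
          linarith [h1.1, h2.2])
      linarith
    -- For a fixed increment, x ↦ f(x + d) - f(x) varies by at most 4δ while its slope is at least
    -- of order Td/N². This bounds the spread; distinct points are at least d apart, because n + d
    -- is the successor of n.
    · refine card_le_of_spaced _ (by linarith) hX0 ?_ ?_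
      · intro n hn n' hn' hlt
        have h1 := (hQm n (Finset.mem_filter.1 hn).1).2.2 n'
          (hQm n' (Finset.mem_filter.1 hn').1).1 hlt
        have h2 : (n : ℝ) + d ≤ n' := by exact_mod_cast h1
        linarith
      · intro n hn n' hn' hlt
        obtain ⟨hn, hy⟩ := Finset.mem_filter.1 hn
        obtain ⟨hn', hy'⟩ := Finset.mem_filter.1 hn'
        have hlt' : (n : ℝ) < n' := by exact_mod_cast hlt
        have e1 := hdiff n hn
        have e2 := hdiff n' hn'
        rw [hy] at e1
        rw [hy'] at e2
        have hn1 := hmem n hn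
        have hn2 := hmem n' hn'
        have hat : ∀ z ∈ Icc (n : ℝ) n', z ∈ Icc (N : ℝ) (2 * N) ∧
            z + d ∈ Icc (N : ℝ) (2 * N) := fun z hz =>
          ⟨⟨by linarith [hz.1], by linarith [hz.2]⟩, ⟨by linarith [hz.1], by linarith [hz.2]⟩⟩
        obtain ⟨ξ, hξ, h1⟩ := exists_hasDerivAt_eq_slope (fun x => F 0 (x + d) - F 0 x)
          (fun x => F 1 (x + d) - F 1 x) hlt' (by
            refine ContinuousOn.sub ?_ ((hF.continuousOn 0).mono fun z hz => (hat z hz).1)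
            exact (hF.continuousOn 0).comp (by fun_prop) fun z hz => (hat z hz).2) (by
            intro z hz
            refine HasDerivAt.sub ?_ (hF.hasDerivAt 0 ⟨by linarith [hz.1], by linarith [hz.2]⟩)
            exact HasDerivAt.comp_add_const z (d : ℝ)
              (hF.hasDerivAt 0 ⟨by linarith [hz.1], by linarith [hz.2]⟩))
        obtain ⟨η, hη, h2⟩ := hF.exists_slope 1 (x := ξ) (y := ξ + d) (by linarith [hξ.1])
          (by linarith) (by linarith [hξ.2])
        have h3 := (hb 2 η hη).1
        rw [h2, add_sub_cancel_left, eq_div_iff (sub_pos.2 hlt').ne'] at h1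
        have h4 : |F 2 η * d * ((n' : ℝ) - n)| ≤ 4 * δ := by
          rw [h1]
          rw [abs_lt] at e1 e2
          rw [abs_le]
          constructor <;> linarith [e1.1, e1.2, e2.1, e2.2]
        rw [abs_mul, abs_mul, Nat.abs_cast, abs_of_pos (sub_pos.2 hlt')] at h4
        have h5 : (c 2)⁻¹ * (T / N ^ 2) * d * ((n' : ℝ) - n) ≤ 4 * δ := by
          refine le_trans ?_ h4
          have := (sub_pos.2 hlt').le
          gcongr
        have h6 : (c 2)⁻¹ * (T / N ^ 2) * d * ((n' : ℝ) - n) =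
            ((n' : ℝ) - n) * (T * d) / (c 2 * N ^ 2) := by field_simp
        rw [h6, div_le_iff₀ (by positivity)] at h5
        rw [le_div_iff₀ (by positivity)]
        calc ((n' : ℝ) - n) * (T ^ 2 * d) = T * (((n' : ℝ) - n) * (T * d)) := by ring
          _ ≤ T * (4 * δ * (c 2 * N ^ 2)) := by gcongr
          _ = (T * δ) * (4 * c 2 * N ^ 2) := by ring
          _ ≤ 1 * (4 * c 2 * N ^ 2) := by gcongr
          _ = _ := one_mul _
  refine hcard.trans ?_
  rw [mul_add, mul_one]
  refine add_le_add ?_ le_rfl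
  have h1 : 3 * V * (4 * c 2 * N ^ 2 / (T ^ 2 * d) / d) = 12 * (c 1 + 2) * c 2 * (N / (T * d)) := by
    rw [hV]; field_simp; ring
  -- A nonzero increment exists, so V ≥ 1; this removes the 1/d from the first term.
  have h2 : (N : ℝ) / (T * d) ≤ c 1 + 2 := by
    rw [div_le_iff₀ (by positivity)]
    rw [hV, le_div_iff₀ (by linarith)] at hV1
    linarith
  rw [h1]
  calc _ ≤ 12 * (c 1 + 2) * c 2 * (c 1 + 2) := by gcongr
    _ = _ := by ring

/-! ### The main term and the second-derivative bound -/

/-- The main term of the bound for the number of close points. -/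
noncomputable def mainTerm (k N : ℕ) (T : ℝ) : ℝ :=
  T ^ (2 / ((k : ℝ) * ((k : ℝ) + 1))) * (N : ℝ) ^ (((k : ℝ) - 1) / ((k : ℝ) + 1))

theorem one_le_mainTerm {k N : ℕ} {T : ℝ} (hk : 1 ≤ k) (hN : 1 ≤ N) (hT : 1 ≤ T) :
    1 ≤ mainTerm k N T := by
  have hN' : (1 : ℝ) ≤ N := by exact_mod_cast hN
  have hk' : (1 : ℝ) ≤ k := by exact_mod_cast hk
  have h1 := Real.one_le_rpow hT (z := 2 / ((k : ℝ) * ((k : ℝ) + 1))) (by positivity)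
  have h2 := Real.one_le_rpow hN' (z := ((k : ℝ) - 1) / ((k : ℝ) + 1))
    (div_nonneg (by linarith) (by linarith))
  exact one_le_mul_of_one_le_of_one_le h1 h2

theorem mainTerm_pow {k N : ℕ} {T : ℝ} (hk : 1 ≤ k) (hT : 0 ≤ T) :
    mainTerm k N T ^ (k + 1).choose 2 = T * (N : ℝ) ^ k.choose 2 := by
  have hk' : (1 : ℝ) ≤ k := by exact_mod_cast hk
  have e1 : (((k + 1).choose 2 : ℕ) : ℝ) = k * (k + 1) / 2 := by
    rw [Nat.cast_choose_two]; push_cast; ring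
  have e2 : ((k.choose 2 : ℕ) : ℝ) = k * (k - 1) / 2 := Nat.cast_choose_two ℝ k
  rw [mainTerm, mul_pow, ← Real.rpow_mul_natCast hT, ← Real.rpow_mul_natCast (Nat.cast_nonneg N),
    ← Real.rpow_natCast (N : ℝ) (k.choose 2), e1, e2]
  congr 1
  · rw [div_mul_div_comm, mul_comm (2 : ℝ), div_self (by positivity), Real.rpow_one]
  · congr 1
    field_simp

/-- In logarithms the difference is a positive multiple of k log N - 2 log T. This disposes of small
T in the induction. -/
theorem mainTerm_le_succ {k N : ℕ} {T : ℝ} (hk : 1 ≤ k) (hN : 1 ≤ N) (hT : 1 ≤ T)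
    (h : T ^ 2 ≤ (N : ℝ) ^ k) : mainTerm k N T ≤ mainTerm (k + 1) N T := by
  have hN' : (0 : ℝ) < N := by exact_mod_cast hN
  have hT0 : 0 < T := by linarith
  have hk' : (1 : ℝ) ≤ k := by exact_mod_cast hk
  have hlog : 2 * Real.log T ≤ k * Real.log N := by
    have := Real.log_le_log (by positivity) h
    rwa [Real.log_pow, Real.log_pow, Nat.cast_two] at this
  simp only [mainTerm, Real.rpow_def_of_pos hN', Real.rpow_def_of_pos hT0, ← Real.exp_add,
    Real.exp_le_exp, Nat.cast_add, Nat.cast_one]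
  set t := Real.log T
  set n := Real.log N
  have hkey : (t * (2 / ((k + 1 : ℝ) * (k + 1 + 1))) + n * ((k + 1 - 1) / (k + 1 + 1 : ℝ))) -
      (t * (2 / (k * (k + 1 : ℝ))) + n * ((k - 1) / (k + 1 : ℝ))) =
      2 / (k * (k + 1) * (k + 2)) * (k * n - 2 * t) := by
    have : (k : ℝ) + 1 + 1 = k + 2 := by ring
    rw [this]
    field_simp
    ring
  have : 0 ≤ 2 / ((k : ℝ) * (k + 1) * (k + 2)) * (k * n - 2 * t) :=
    mul_nonneg (by positivity) (by linarith)
  linarith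

/-- The second derivative bound. -/
theorem exists_closeCount_le_two (c : ℕ → ℝ) (hc : ∀ j, 1 ≤ c j) :
    ∃ C : ℝ, 0 < C ∧ ∀ (N : ℕ) (δ T : ℝ) (f : ℝ → ℝ), 1 ≤ N → 0 < δ → 1 ≤ T →
      DerivsComparable c N T f → (N : ℝ) * δ ≤ T → T ≤ δ⁻¹ →
      (closeCount f N δ : ℝ) ≤ C * mainTerm 2 N T := by
  have hc0 := hc 0
  have hc1 := hc 1
  have hc2 := hc 2
  refine ⟨(2 * c 0 + 3) * (2 * c 1 + 1) * (2 * c 1) +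
    (3 + 12 * (c 1 + 2) ^ 2 * c 2 + 3 * (c 1 + 2)), by positivity, ?_⟩
  intro N δ T f hN hδ hT hf hNδ hTδ
  have hN' : (1 : ℝ) ≤ N := by exact_mod_cast hN
  have hX1 := one_le_mainTerm (k := 2) one_le_two hN hT
  have hXpow := mainTerm_pow (k := 2) (N := N) (T := T) one_le_two (by linarith)
  set X := mainTerm 2 N T with hX
  have hX3 : X ^ 3 = T * N := by simpa [Nat.choose] using hXpow
  rcases le_or_gt (T ^ 2) (2 * c 1 * N) with hsm | hbig
  · have h1 := closeCount_le_mul hc hN hδ hT hf hNδ hTδ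
    have h2 : T ≤ 2 * c 1 * X := by
      refine le_of_pow_le_pow_left₀ three_ne_zero (by positivity) ?_
      calc T ^ 3 = T * T ^ 2 := by ring
        _ ≤ T * (2 * c 1 * N) := by gcongr
        _ = 2 * c 1 * X ^ 3 := by rw [hX3]; ring
        _ ≤ (2 * c 1) ^ 3 * X ^ 3 := by
            gcongr; exact le_self_pow₀ (by linarith) three_ne_zero
        _ = _ := by ring
    calc _ ≤ (2 * c 0 + 3) * (2 * c 1 + 1) * T := h1
      _ ≤ (2 * c 0 + 3) * (2 * c 1 + 1) * (2 * c 1 * X) := by gcongr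
      _ = (2 * c 0 + 3) * (2 * c 1 + 1) * (2 * c 1) * X := by ring
      _ ≤ _ := by
          gcongr
          have : 0 ≤ 3 + 12 * (c 1 + 2) ^ 2 * c 2 + 3 * (c 1 + 2) := by positivity
          linarith
  · obtain ⟨F, rfl, hF, hb⟩ := hf.exists_tower hN
    obtain ⟨S, hcount, hS, hSm⟩ := exists_finset_closePoints (F 0) N δ
    have hTδ' : T * δ ≤ 1 := by
      calc T * δ ≤ δ⁻¹ * δ := by gcongr
        _ = 1 := inv_mul_cancel₀ hδ.ne'
    -- This cut-off balances the count N/Y for long gaps with the sum TY²/N over short ones: both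
    -- equal X.
    set Y : ℝ := N / X with hY
    have hX0 : 0 < X := by linarith
    have hY0 : 0 < Y := by positivity
    have hNX : (N : ℝ) ≤ X ^ 2 := by
      refine le_of_pow_le_pow_left₀ three_ne_zero (by positivity) ?_
      have h1 : (N : ℝ) ≤ T ^ 2 := by nlinarith
      calc (N : ℝ) ^ 3 = N * N ^ 2 := by ring
        _ ≤ T ^ 2 * N ^ 2 := by gcongr
        _ = (X ^ 3) ^ 2 := by rw [hX3]; ring
        _ = _ := by ring
    have hYX : Y ≤ X := by
      rw [hY, div_le_iff₀ hX0, ← sq]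
      exact hNX
    have hTY : T * Y ^ 2 / N = X := by
      rw [hY]
      have : T * (N / X) ^ 2 / N = T * N / X ^ 2 := by field_simp
      rw [this, ← hX3]
      field_simp
    have h1 := card_le_by_gaps S (D := N) hY0 (by linarith)
      (fun n hn n' hn' => by linarith [(hS n hn).1, (hS n' hn').2])
    have hNY : (N : ℝ) / Y = X := by rw [hY]; field_simp
    rw [hNY] at h1
    have h2 : ∀ d ∈ Finset.Icc 1 ⌊Y⌋₊,
        ((S.filter fun n => n + (d : ℤ) ∈ S ∧ ∀ n' ∈ S, n < n' → n + (d : ℤ) ≤ n').card : ℝ) ≤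
        12 * (c 1 + 2) ^ 2 * c 2 + 3 * ((c 1 + 2) * T * Y / N) := by
      intro d hd
      obtain ⟨hd1, hdY⟩ := Finset.mem_Icc.1 hd
      refine (card_gap_le hc hN hT hF hb hNδ hTδ' hbig S (fun n => round (F 0 n)) hS hSm
        hd1).trans ?_
      have : (d : ℝ) ≤ Y := (Nat.le_floor_iff hY0.le).1 hdY
      gcongr
    have h3 := Finset.sum_le_card_nsmul _ _ _ h2
    rw [Nat.card_Icc, Nat.add_sub_cancel, nsmul_eq_mul] at h3
    have h4 : (⌊Y⌋₊ : ℝ) ≤ Y := Nat.floor_le hY0.le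
    rw [hcount]
    calc (S.card : ℝ) ≤ (X + 2) + Y * (12 * (c 1 + 2) ^ 2 * c 2 +
          3 * ((c 1 + 2) * T * Y / N)) := by
          refine h1.trans (add_le_add le_rfl (h3.trans ?_))
          gcongr
      _ = (X + 2) + (12 * (c 1 + 2) ^ 2 * c 2 * Y + 3 * (c 1 + 2) * (T * Y ^ 2 / N)) := by ring
      _ = (X + 2) + (12 * (c 1 + 2) ^ 2 * c 2 * Y + 3 * (c 1 + 2) * X) := by rw [hTY]
      _ ≤ (X + 2 * X) + (12 * (c 1 + 2) ^ 2 * c 2 * X + 3 * (c 1 + 2) * X) := by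
          gcongr; linarith
      _ = 0 * X + (3 + 12 * (c 1 + 2) ^ 2 * c 2 + 3 * (c 1 + 2)) * X := by ring
      _ ≤ (2 * c 0 + 3) * (2 * c 1 + 1) * (2 * c 1) * X +
          (3 + 12 * (c 1 + 2) ^ 2 * c 2 + 3 * (c 1 + 2)) * X := by
          gcongr; positivity
      _ = _ := by ring

/-! ### Higher derivatives and the induction on k -/

theorem choose_two_mul_succ (k : ℕ) : k.choose 2 * (k + 1) = (k + 1).choose 2 * (k - 1) := by
  rcases k with _ | k
  · simp
  have e1 : (k + 1).choose 2 * 2 = (k + 1) * k := by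
    rw [Nat.choose_two_right, Nat.div_mul_cancel (Nat.even_mul_pred_self _).two_dvd]
    simp
  have e2 : (k + 1 + 1).choose 2 * 2 = (k + 2) * (k + 1) := by
    rw [Nat.choose_two_right, Nat.div_mul_cancel (Nat.even_mul_pred_self _).two_dvd]
    simp
  rw [Nat.add_sub_cancel]
  nlinarith

/-- The bound by the `k`-th derivative for `k ≥ 3`, when `T` is not too small. -/
theorem exists_closeCount_le_of_large (c : ℕ → ℝ) (hc : ∀ j, 1 ≤ c j) {k : ℕ} (hk : 3 ≤ k) :
    ∃ C : ℝ, 0 < C ∧ ∀ (N : ℕ) (δ T : ℝ) (f : ℝ → ℝ), 1 ≤ N → 0 < δ → 1 ≤ T →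
      DerivsComparable c N T f → T ≤ δ⁻¹ → (N : ℝ) ^ (k - 1) ≤ T ^ 2 →
      (closeCount f N δ : ℝ) ≤ C * mainTerm k N T := by
  have hk0 : 0 < k := by omega
  have hck := hc k
  have hck0 : 0 < c k := by linarith
  -- The ratio of the upper to the lower bound for the k-th derivative.
  set κ : ℝ := c k ^ 2 with hκ
  have hκ0 : 0 ≤ κ := by positivity
  have hic := isolationConst_pos hk0 hκ0
  have hlc := one_le_lengthConst hk0
  set ic := isolationConst k κ with hicdef
  set lc := lengthConst k with hlcdef
  obtain ⟨K, hK, hK'⟩ : ∃ K : ℕ, k * k ≤ K ∧ 1 ≤ ic * K := by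
    refine ⟨max (k * k) ⌈ic⁻¹⌉₊, le_max_left _ _, ?_⟩
    have h1 : ic⁻¹ ≤ ((max (k * k) ⌈ic⁻¹⌉₊ : ℕ) : ℝ) :=
      (Nat.le_ceil _).trans (by exact_mod_cast le_max_right _ _)
    calc (1 : ℝ) = ic * ic⁻¹ := (mul_inv_cancel₀ hic.ne').symm
      _ ≤ _ := by gcongr
  -- Shrinking blocks by this factor bounds the integer determinant by (c k + k + 1) c₀ < 1.
  set c₀ : ℝ := (c k + k + 2)⁻¹ with hc₀
  have hc₀pos : 0 < c₀ := by positivity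
  have hc₀le : c₀ ≤ 1 := inv_le_one_of_one_le₀ (by
    have : (0 : ℝ) ≤ k := Nat.cast_nonneg k
    linarith)
  refine ⟨k * (K * (c₀⁻¹ + 1) + (3 / (ic * c₀) * 2 + (lc * c k + 1))), by positivity, ?_⟩
  intro N δ T f hN hδ hT hf hTδ hbig
  have hN' : (1 : ℝ) ≤ N := by exact_mod_cast hN
  have hX1 := one_le_mainTerm (k := k) (by omega) hN hT
  have hXpow := mainTerm_pow (k := k) (N := N) (T := T) (by omega) (by linarith)
  set X := mainTerm k N T with hX
  have hX0 : 0 < X := by linarith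
  have hT0 : 0 < T := by linarith
  have hN0 : (0 : ℝ) < N := by linarith
  obtain ⟨F, rfl, hF, hb⟩ := hf.exists_tower hN
  obtain ⟨S, hcount, hS, hSm⟩ := exists_finset_closePoints (F 0) N δ
  set Y : ℝ := N / X with hY
  have hY0 : 0 < Y := by positivity
  set e := k.choose 2 with he
  have hke : k ≤ e := le_choose_two hk
  have hch : (k + 1).choose 2 = k + e := by
    rw [Nat.choose_succ_succ' k 1, Nat.choose_one_right]
  have hYpow : Y ^ (k + 1).choose 2 = N ^ k / T := by
    rw [hY, div_pow, hXpow, hch, pow_add]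
    field_simp
  -- Raised to the power k + 1, this is exactly the assumption N^(k-1) ≤ T².
  have hYe : Y ^ e ≤ T := by
    refine le_of_pow_le_pow_left₀ (n := k + 1) (by omega) hT0.le ?_
    rw [← pow_mul, choose_two_mul_succ, pow_mul, hYpow, div_pow, div_le_iff₀ (by positivity),
      ← pow_add]
    calc ((N : ℝ) ^ k) ^ (k - 1) = (N ^ (k - 1)) ^ k := by rw [← pow_mul, ← pow_mul, mul_comm]
      _ ≤ (T ^ 2) ^ k := by gcongr
      _ = T ^ (k + 1 + (k - 1)) := by rw [← pow_mul]; congr 1; omega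
  have hδT : δ * T ≤ 1 := by
    calc δ * T ≤ δ * δ⁻¹ := by gcongr
      _ = 1 := mul_inv_cancel₀ hδ.ne'
  have hδY : δ * Y ^ e ≤ 1 := le_trans (by gcongr) hδT
  set L := c₀ * Y with hL
  have hL0 : 0 < L := by positivity
  have hδL : δ * L ^ e ≤ c₀ := by
    rw [hL, mul_pow]
    calc δ * (c₀ ^ e * Y ^ e) = c₀ ^ e * (δ * Y ^ e) := by ring
      _ ≤ c₀ * 1 := by
          gcongr
          exact pow_le_of_le_one hc₀pos.le hc₀le (by omega)
      _ = c₀ := mul_one _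
  set lam := (c k)⁻¹ * (T / N ^ k) with hlamdef
  have hκlam : κ * lam = c k * (T / N ^ k) := by
    rw [hκ, hlamdef]; field_simp
  have hYk : Y ^ k ≤ T ^ 2 := by
    rcases le_or_gt Y 1 with h1 | h1
    · exact (pow_le_one₀ hY0.le h1).trans (one_le_pow₀ hT)
    · calc Y ^ k ≤ Y ^ e := pow_le_pow_right₀ h1.le hke
        _ ≤ T := hYe
        _ ≤ T ^ 2 := le_self_pow₀ hT two_ne_zero
  -- E = c k · X bounds the exceptional arc: δ ≤ `lam` E^k reduces to δ Y^k ≤ T, which follows from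
  -- Y^k ≤ T² and δT ≤ 1.
  have hmain := card_close_le hF (by linarith) hk (lam := lam) (κ := κ) (δ := δ) (L := L)
    (E := c k * X) hκ0 (by positivity)
    (fun x hx => ⟨(hb k x hx).1, by rw [hκlam]; exact (hb k x hx).2⟩) hδ hL0
    (hδL.trans hc₀le) (by
      have h1 : κ * lam / k.factorial * L ^ (k + 1).choose 2 ≤ c k * c₀ := by
        have hf1 : (1 : ℝ) ≤ k.factorial := by exact_mod_cast Nat.succ_le_of_lt k.factorial_pos
        calc κ * lam / k.factorial * L ^ (k + 1).choose 2
            ≤ κ * lam * L ^ (k + 1).choose 2 := by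
              gcongr
              exact div_le_self (by positivity) hf1
          _ = c k * c₀ ^ (k + 1).choose 2 := by
              rw [hκlam, hL, mul_pow, hYpow]
              field_simp
          _ ≤ c k * c₀ := by
              gcongr
              exact pow_le_of_le_one hc₀pos.le hc₀le (by omega)
      calc _ ≤ c k * c₀ + (k + 1) * (δ * L ^ e) := by
            rw [mul_assoc _ δ]
            gcongr
        _ ≤ c k * c₀ + (k + 1) * c₀ := by gcongr
        _ = (c k + k + 1) / (c k + k + 2) := by rw [hc₀]; ring
        _ < 1 := by
            rw [div_lt_one (by positivity)]
            linarith)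
    (by positivity) (by
      have h1 : lam * (c k * X) ^ k = (c k)⁻¹ * c k ^ k * (T / Y ^ k) := by
        rw [hlamdef, hY, div_pow, mul_pow]
        field_simp
      have h2 : 1 ≤ (c k)⁻¹ * c k ^ k := by
        rw [inv_mul_eq_div, one_le_div hck0]
        exact le_self_pow₀ hck hk0.ne'
      rw [h1]
      calc δ ≤ T / Y ^ k := by
            rw [le_div_iff₀ (by positivity)]
            calc δ * Y ^ k ≤ δ * T ^ 2 := by gcongr
              _ = δ * T * T := by ring
              _ ≤ 1 * T := by gcongr
              _ = T := one_mul T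
        _ ≤ _ := le_mul_of_one_le_left (by positivity) h2)
    (fun n => round (F 0 n)) S hS hSm K hK hK'
  rw [hcount]
  have hBA : (2 * (N : ℝ) - N) = N := by ring
  have hNL : (N : ℝ) / L = c₀⁻¹ * X := by rw [hL, hY]; field_simp
  rw [hBA, ← hicdef, ← hlcdef, hNL] at hmain
  have h3 : 3 / (ic * L) * (2 * N) = 3 / (ic * c₀) * 2 * X := by
    rw [hL, hY]; field_simp
  rw [h3] at hmain
  calc (S.card : ℝ) ≤ _ := hmain
    _ ≤ k * (K * (c₀⁻¹ * X + X) + (3 / (ic * c₀) * 2 * X + (lc * (c k * X) + X))) := by gcongr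
    _ = _ := by ring

theorem mainTheorem10 (k : ℕ) (hk : 1 ≤ k) (c : ℕ → ℝ) (hc : ∀ j, 1 ≤ c j) :
    ∃ C : ℝ, 0 < C ∧
      ∀ (N : ℕ) (δ T : ℝ) (f : ℝ → ℝ), 1 ≤ N → 0 < δ → 1 ≤ T →
        DerivsComparable c N T f →
        (N : ℝ) * δ ≤ T → T ≤ δ⁻¹ →
        (closeCount f N δ : ℝ) ≤
          C * (T ^ (2 / ((k : ℝ) * ((k : ℝ) + 1))) *
            (N : ℝ) ^ (((k : ℝ) - 1) / ((k : ℝ) + 1))) := by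
  induction k, hk using Nat.le_induction with
  | base =>
    have hc0 := hc 0
    have hc1 := hc 1
    refine ⟨(2 * c 0 + 3) * (2 * c 1 + 1), by positivity, ?_⟩
    intro N δ T f hN hδ hT hf hNδ hTδ
    refine (closeCount_le_mul hc hN hδ hT hf hNδ hTδ).trans_eq ?_
    norm_num
  | succ k hk ih =>
    rcases hk.eq_or_lt with rfl | hk2
    · exact exists_closeCount_le_two c hc
    obtain ⟨C₁, hC₁, h₁⟩ := ih
    obtain ⟨C₂, hC₂, h₂⟩ := exists_closeCount_le_of_large c hc (k := k + 1) (by omega)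
    refine ⟨C₁ + C₂, by positivity, ?_⟩
    intro N δ T f hN hδ hT hf hNδ hTδ
    change _ ≤ (C₁ + C₂) * mainTerm (k + 1) N T
    have hX := one_le_mainTerm (k := k + 1) (by omega) hN hT
    -- For large T the (k + 1)-st derivative is used directly; for small T the inductive bound
    -- already suffices.
    rcases le_total ((N : ℝ) ^ k) (T ^ 2) with h | h
    · have := h₂ N δ T f hN hδ hT hf hTδ h
      nlinarith
    · have h3 : (closeCount f N δ : ℝ) ≤ C₁ * mainTerm k N T := h₁ N δ T f hN hδ hT hf hNδ hTδ
      have h4 := mainTerm_le_succ hk hN hT h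
      nlinarith
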